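/- Let $L>0$, $\kappa_1>0$, $\kappa_2\in\mathbb R$, and let $$\Phi(s)=\begin{cases}\kappa_2^2s^2/2,&|s|\le 1,\\ \kappa_2^2/2,&|s|>1,\end{cases}$$ with (Clarke) subdifferential $\partial\Phi(s)=\{\kappa_2^2 s\}$ if $|s|<1$, $\{0\}$ if $|s|>1$, $[0,\kappa_2^2]$ if $s=1$ and $[-\kappa_2^2,0]$ if $s=-1$. Given $v_0\in H^2(0,L)$ and $v_1\in L^2(0,L)$, consider the problem $$u_{tt}=-\kappa_1^2u_{xxxx}-\Phi'(u)\ \text{ for } t>0,\ 0<x<L,\qquad u_x=u_{xxx}=0\ \text{ at } x=0,L,\qquad u(0,\cdot)=v_0,\quad u_t(0,\cdot)=v_1. \tag{1}$$ A function $u:[0,\infty)\times[0,L]\to\mathbb R$ is a *dissipative solution* of (1) if (i) $u$ is continuous on $[0,\infty)\times[0,L]$; (ii) the weak derivatives satisfy $\partial_tu,\ \partial_{xx}^2u\in L^\infty(0,\infty;L^2(0,L))$, and $u\in L^\infty(0,T;H^2(0,L))$ for every $T>0$; (iii) $\partial_xu(t,0)=\partial_xu(t,L)=0$ for a.e. $t>0$;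 (iv) there is a measurable function $h$ with $h(t,x)\in\partial\Phi(u(t,x))$ for a.e. $(t,x)\in(0,\infty)\times(0,L)$ such that, for every $\varphi\in C_c^\infty(\mathbb R^2)$ with $\partial_x\varphi(\cdot,0)=\partial_x\varphi(\cdot,L)=0$, $$\int_0^\infty\!\!\int_0^L\big(u\,\partial_{tt}^2\varphi+\kappa_1^2\,\partial_{xx}^2u\,\partial_{xx}^2\varphi+h\varphi\big)\,dx\,dt-\int_0^Lv_1(x)\varphi(0,x)\,dx+\int_0^Lv_0(x)\,\partial_t\varphi(0,x)\,dx=0;$$ (v) $E[u](t)\le E[u](0)$ for a.e. $t>0$, where $$E[u](t)=\int_0^L\Big(\frac{(\partial_tu(t,x))^2+\kappa_1^2(\partial_{xx}^2u(t,x))^2}{2}+\Phi(u(t,x))\Big)dx,\qquad E[u](0)=\int_0^L\Big(\frac{v_1^2+\kappa_1^2(v_0'')^2}{2}+\Phi(v_0)\Big)dx.$$ **Theorem.** Let $u$ be a dissipative solution of (1). Assume that $v_0$ and $v_1$ are (a.e. equal to) constants with $|v_0|<1$; that $\bar t>0$ is a time such that $|u(\bar t,x)|>1$ for every $x\in[0,L]$;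 that $u\in C^1([0,\infty)\times[0,L])$; and that the energy is preserved, i.e. $E[u](t)=E[u](0)$ for a.e. $t>0$. Then for every $t\ge\bar t$ the function $x\mapsto u(t,x)$ is constant on $[0,L]$. -/

import Mathlib

open MeasureTheory Set Filter Topology
open scoped ContDiff NNReal

noncomputable section

namespace Beam

/-! Space-time points are pairs `(t, x) : ℝ × ℝ`, time first. -/

/-- `g` is the weak (distributional) derivative of `f` in the direction `e` on the open set `Ω`:
both are locally integrable on `Ω` and `∫_Ω f ∂ₑφ = -∫_Ω g φ` for all `φ ∈ C_c^∞(Ω)`. -/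
def HasWeakDerivAlong {E : Type*} [NormedAddCommGroup E] [NormedSpace ℝ E] [MeasureSpace E]
    (Ω : Set E) (e : E) (f g : E → ℝ) : Prop :=
  LocallyIntegrableOn f Ω ∧ LocallyIntegrableOn g Ω ∧
    ∀ φ : E → ℝ, ContDiff ℝ ∞ φ → HasCompactSupport φ → tsupport φ ⊆ Ω →
      ∫ z in Ω, f z * fderiv ℝ φ z e = -∫ z in Ω, g z * φ z

open Classical in
/-- The weak derivative of `f` in the direction `e` on `Ω` (determined up to a null set of `Ω`
whenever it exists; the zero function, by convention, if it does not exist). -/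
def weakDerivAlong {E : Type*} [NormedAddCommGroup E] [NormedSpace ℝ E] [MeasureSpace E]
    (Ω : Set E) (e : E) (f : E → ℝ) : E → ℝ :=
  if h : ∃ g, HasWeakDerivAlong Ω e f g then h.choose else 0

/-- `f` has a weak derivative in the direction `e` on `Ω`. -/
def WeaklyDifferentiableAlong {E : Type*} [NormedAddCommGroup E] [NormedSpace ℝ E]
    [MeasureSpace E] (Ω : Set E) (e : E) (f : E → ℝ) : Prop :=
  ∃ g, HasWeakDerivAlong Ω e f g

/-- The space-time domain `(0, ∞) × (0, L)`. -/
def strip (L : ℝ) : Set (ℝ × ℝ) := Ioi 0 ×ˢ Ioo 0 L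

/-- Its closure `[0, ∞) × [0, L]`. -/
def closedStrip (L : ℝ) : Set (ℝ × ℝ) := Ici 0 ×ˢ Icc 0 L

/-- The weak derivative `∂ₜ u` on `(0, ∞) × (0, L)`. -/
def weakDt (L : ℝ) (u : ℝ × ℝ → ℝ) : ℝ × ℝ → ℝ := weakDerivAlong (strip L) (1, 0) u

/-- The weak derivative `∂ₓ u` on `(0, ∞) × (0, L)`. -/
def weakDx (L : ℝ) (u : ℝ × ℝ → ℝ) : ℝ × ℝ → ℝ := weakDerivAlong (strip L) (0, 1) u

/-- The weak derivative `∂ₓₓ u` on `(0, ∞) × (0, L)`. -/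
def weakDxx (L : ℝ) (u : ℝ × ℝ → ℝ) : ℝ × ℝ → ℝ := weakDx L (weakDx L u)

/-- The weak derivative of a function of `x` on `(0, L)`. -/
def weakDeriv (L : ℝ) (v : ℝ → ℝ) : ℝ → ℝ := weakDerivAlong (Ioo 0 L) (1 : ℝ) v

/-- `v ∈ L²(0, L)`. -/
def MemL2 (L : ℝ) (v : ℝ → ℝ) : Prop := MemLp v 2 (volume.restrict (Ioo 0 L))

/-- `v ∈ H²(0, L)`. -/
def MemH2 (L : ℝ) (v : ℝ → ℝ) : Prop :=
  MemL2 L v ∧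
  WeaklyDifferentiableAlong (Ioo 0 L) (1 : ℝ) v ∧ MemL2 L (weakDeriv L v) ∧
  WeaklyDifferentiableAlong (Ioo 0 L) (1 : ℝ) (weakDeriv L v) ∧
    MemL2 L (weakDeriv L (weakDeriv L v))

/-- `g ∈ L^∞(I; L²(0, L))` for a set `I` of times. -/
def MemLinftyL2 (I : Set ℝ) (L : ℝ) (g : ℝ × ℝ → ℝ) : Prop :=
  AEStronglyMeasurable g (volume.restrict (I ×ˢ Ioo 0 L)) ∧
    ∃ C : ℝ≥0, ∀ᵐ t ∂(volume.restrict I),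
      eLpNorm (fun x => g (t, x)) 2 (volume.restrict (Ioo 0 L)) ≤ C

/-- The adhesive potential `Φ`. -/
def potential (κ₂ s : ℝ) : ℝ := if |s| ≤ 1 then κ₂ ^ 2 * s ^ 2 / 2 else κ₂ ^ 2 / 2

/-- The (Clarke) subdifferential of a locally Lipschitz function `f : ℝ → ℝ` at `s`: the convex
hull of all limits of `f'(yₙ)` along sequences `yₙ → s` of points of differentiability.  For
`f = Φ` it is `{Φ'(s)}` if `|s| ≠ 1`, `[0, κ₂²]` if `s = 1` and `[-κ₂², 0]` if `s = -1`. -/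
def subdifferential (f : ℝ → ℝ) (s : ℝ) : Set ℝ :=
  convexHull ℝ {ξ : ℝ | ∃ y : ℕ → ℝ, Tendsto y atTop (𝓝 s) ∧
    (∀ n, DifferentiableAt ℝ f (y n)) ∧ Tendsto (fun n => deriv f (y n)) atTop (𝓝 ξ)}

/-- `∫₀ᴸ ((p² + κ₁² q²) / 2 + Φ(w)) dx`, the energy of a state with displacement `w`,
velocity `p` and second space derivative `q`. -/
def stateEnergy (κ₁ κ₂ L : ℝ) (w p q : ℝ → ℝ) : ℝ :=
  ∫ x in Ioo 0 L, (((p x) ^ 2 + κ₁ ^ 2 * (q x) ^ 2) / 2 + potential κ₂ (w x))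

/-- The energy `E[u](t)`; for a dissipative solution it is determined for almost every `t`. -/
def energy (κ₁ κ₂ L : ℝ) (u : ℝ × ℝ → ℝ) (t : ℝ) : ℝ :=
  stateEnergy κ₁ κ₂ L (fun x => u (t, x)) (fun x => weakDt L u (t, x))
    (fun x => weakDxx L u (t, x))

/-- The initial energy `E[u](0)`, expressed through the initial data `v₀`, `v₁`. -/
def initialEnergy (κ₁ κ₂ L : ℝ) (v₀ v₁ : ℝ → ℝ) : ℝ :=
  stateEnergy κ₁ κ₂ L v₀ v₁ (weakDeriv L (weakDeriv L v₀))

/-- Classical `∂ₜ φ`, for smooth test functions. -/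
def partialT (φ : ℝ × ℝ → ℝ) (z : ℝ × ℝ) : ℝ := fderiv ℝ φ z (1, 0)

/-- Classical `∂ₓ φ`, for smooth test functions. -/
def partialX (φ : ℝ × ℝ → ℝ) (z : ℝ × ℝ) : ℝ := fderiv ℝ φ z (0, 1)

/-- Weak formulation, with initial data `v₀`, `v₁`, of `u_tt = -κ₁² u_xxxx - h` on
`(0, ∞) × (0, L)` with `u_x = u_xxx = 0` at `x = 0, L`. -/
def IsWeakSolution (κ₁ L : ℝ) (v₀ v₁ : ℝ → ℝ) (u h : ℝ × ℝ → ℝ) : Prop :=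
  ∀ φ : ℝ × ℝ → ℝ, ContDiff ℝ ∞ φ → HasCompactSupport φ →
    (∀ t, partialX φ (t, 0) = 0) → (∀ t, partialX φ (t, L) = 0) →
    (∫ z in strip L, (u z * partialT (partialT φ) z
        + κ₁ ^ 2 * weakDxx L u z * partialX (partialX φ) z + h z * φ z))
      - (∫ x in Ioo 0 L, v₁ x * φ (0, x)) + (∫ x in Ioo 0 L, v₀ x * partialT φ (0, x)) = 0

/-- `u` is a dissipative solution on `[0, ∞) × [0, L]` of
`u_tt = -κ₁² u_xxxx - Φ'(u)`, `u_x = u_xxx = 0` at `x = 0, L`, `u(0, ·) = v₀`, `u_t(0, ·) = v₁`. -/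
structure IsDissipativeSolution (κ₁ κ₂ L : ℝ) (v₀ v₁ : ℝ → ℝ) (u : ℝ × ℝ → ℝ) : Prop where
  memH2_data : MemH2 L v₀
  memL2_data : MemL2 L v₁
  continuousOn : ContinuousOn u (closedStrip L)
  exists_dt : WeaklyDifferentiableAlong (strip L) (1, 0) u
  exists_dx : WeaklyDifferentiableAlong (strip L) (0, 1) u
  exists_dxx : WeaklyDifferentiableAlong (strip L) (0, 1) (weakDx L u)
  dt_mem : MemLinftyL2 (Ioi 0) L (weakDt L u)
  dxx_mem : MemLinftyL2 (Ioi 0) L (weakDxx L u)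
  /-- `u ∈ L^∞(0, T; H²(0, L))` for every `T > 0`. -/
  mem_H2 : ∀ T : ℝ, 0 < T → MemLinftyL2 (Ioo 0 T) L u ∧ MemLinftyL2 (Ioo 0 T) L (weakDx L u) ∧
    MemLinftyL2 (Ioo 0 T) L (weakDxx L u)
  /-- `∂ₓ u(t, 0) = ∂ₓ u(t, L) = 0` for a.e. `t > 0` (one-sided derivatives; `u(t, ·)` belongs to
  `H²(0, L)`, hence to `C¹([0, L])`, for a.e. `t`). -/
  boundary : ∀ᵐ t ∂(volume.restrict (Ioi (0 : ℝ))),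
    HasDerivWithinAt (fun x => u (t, x)) 0 (Icc 0 L) 0 ∧
    HasDerivWithinAt (fun x => u (t, x)) 0 (Icc 0 L) L
  weak : ∃ h : ℝ × ℝ → ℝ, AEStronglyMeasurable h (volume.restrict (strip L)) ∧
    (∀ᵐ z ∂(volume.restrict (strip L)), h z ∈ subdifferential (potential κ₂) (u z)) ∧
    IsWeakSolution κ₁ L v₀ v₁ u h
  dissipation : ∀ᵐ t ∂(volume.restrict (Ioi (0 : ℝ))),
    energy κ₁ κ₂ L u t ≤ initialEnergy κ₁ κ₂ L v₀ v₁

end Beam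

end

/-!
Testing the equation with functions of `t` alone kills the bending term, so the mean velocity `p` of
the beam satisfies `p' = -m` in the integrated sense, where `m` is the mean of the force `h`. During
a time interval in which the values of `u` stay where `Φ(s) = k s² / 2 + d` with `k ≥ 0`, the force
is `h = k u`, hence `p' = -k y` with `y` the mean displacement, and `p² / 2 + k y² / 2 + d` is
conserved. By Jensen's inequality the energy per unit length is at least this quantity; if the two
agree at the start of the interval, the energy inequality leaves no room, and the equality case of
Jensen makes `∂ₜu` independent of `x`: a beam that starts out straight remains straight.

At a time when the beam is straight with `|u| = 1`, the energy per unit length is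
`p² / 2 + κ₂² / 2`. Unless it equals `κ₂² / 2`, the velocity does not vanish, and immediately
afterwards the beam is either attached or detached along its whole length, so the previous argument
applies; continuous induction over the closed set of straight times reaches every `t ≥ 0`. In the
exceptional case the velocity of an entirely detached beam vanishes, so a beam that was in contact
at some time can never become entirely detached.
-/

namespace Beam

section WeakDerivative

theorem integrableOn_mul_of_isCompact {X : Type*} [TopologicalSpace X] [T2Space X]
    [MeasurableSpace X] [OpensMeasurableSpace X] {μ : Measure X} {S K : Set X} {f g : X → ℝ}
    (hf : LocallyIntegrableOn f S μ) (hS : MeasurableSet S) (hK : IsCompact K) (hKS : K ⊆ S)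
    (hg : ContinuousOn g K) (hg₀ : ∀ z ∈ S \ K, g z = 0) :
    IntegrableOn (fun z => f z * g z) S μ :=
  ((hf.integrableOn_compact_subset hKS hK).mul_continuousOn hg hK).of_forall_sdiff_eq_zero hS
    fun z hz => by rw [hg₀ z hz, mul_zero]

variable {E : Type*} [NormedAddCommGroup E] [MeasureSpace E] {Ω : Set E}

theorem WeaklyDifferentiableAlong.hasWeakDerivAlong [NormedSpace ℝ E] {e : E} {f : E → ℝ}
    (h : WeaklyDifferentiableAlong Ω e f) : HasWeakDerivAlong Ω e f (weakDerivAlong Ω e f) := by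
  have hex : ∃ g, HasWeakDerivAlong Ω e f g := h
  rw [weakDerivAlong, dif_pos hex]
  exact hex.choose_spec

theorem setIntegral_mul_eq_integral_of_tsupport_subset {φ : E → ℝ} (hφ : tsupport φ ⊆ Ω)
    (f : E → ℝ) : ∫ z in Ω, f z * φ z = ∫ z, f z * φ z :=
  setIntegral_eq_integral_of_forall_compl_eq_zero fun z hz => by
    rw [image_eq_zero_of_notMem_tsupport fun h => hz (hφ h), mul_zero]

variable [BorelSpace E]

theorem integrable_mul_of_tsupport_subset (hΩ : IsOpen Ω) {f φ : E → ℝ}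
    (hf : LocallyIntegrableOn f Ω) (hφ : Continuous φ) (hc : HasCompactSupport φ)
    (hs : tsupport φ ⊆ Ω) : Integrable (fun z => f z * φ z) :=
  (integrableOn_mul_of_isCompact hf hΩ.measurableSet hc hs hφ.continuousOn
    fun _ hz => image_eq_zero_of_notMem_tsupport hz.2).integrable_of_forall_notMem_eq_zero
    fun z hz => by rw [image_eq_zero_of_notMem_tsupport fun h => hz (hs h), mul_zero]

variable [NormedSpace ℝ E] [FiniteDimensional ℝ E] {e : E} {f g f' g' : E → ℝ}

theorem ae_eq_of_forall_integral_mul_eq (hΩ : IsOpen Ω) (hf : LocallyIntegrableOn f Ω)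
    (hg : LocallyIntegrableOn g Ω)
    (h : ∀ φ : E → ℝ, ContDiff ℝ ∞ φ → HasCompactSupport φ → tsupport φ ⊆ Ω →
      ∫ z in Ω, f z * φ z = ∫ z in Ω, g z * φ z) :
    f =ᵐ[volume.restrict Ω] g := by
  have hae : ∀ᵐ z, z ∈ Ω → (f - g) z = 0 := by
    refine hΩ.ae_eq_zero_of_integral_contDiff_smul_eq_zero (hf.sub hg) fun φ hφ hc hs => ?_
    have heq := h φ hφ hc hs
    rw [setIntegral_mul_eq_integral_of_tsupport_subset hs,
      setIntegral_mul_eq_integral_of_tsupport_subset hs] at heq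
    calc ∫ z, φ z • (f - g) z = ∫ z, (f z * φ z - g z * φ z) := by
          simp only [smul_eq_mul, Pi.sub_apply, mul_sub, mul_comm]
      _ = 0 := by
        rw [integral_sub (integrable_mul_of_tsupport_subset hΩ hf hφ.continuous hc hs)
          (integrable_mul_of_tsupport_subset hΩ hg hφ.continuous hc hs), heq, sub_self]
  filter_upwards [ae_restrict_of_ae hae, ae_restrict_mem hΩ.measurableSet] with z hz hzΩ
  exact sub_eq_zero.1 (hz hzΩ)

theorem HasWeakDerivAlong.ae_eq (hΩ : IsOpen Ω) (hg : HasWeakDerivAlong Ω e f g)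
    (hg' : HasWeakDerivAlong Ω e f' g') (hff' : f =ᵐ[volume.restrict Ω] f') :
    g =ᵐ[volume.restrict Ω] g' := by
  refine ae_eq_of_forall_integral_mul_eq hΩ hg.2.1 hg'.2.1 fun φ hφ hc hs => ?_
  rw [← neg_inj, ← hg.2.2 φ hφ hc hs, ← hg'.2.2 φ hφ hc hs]
  exact integral_congr_ae (hff'.mono fun z hz => by simp only [hz])

theorem hasWeakDerivAlong_fderiv [(volume : Measure E).IsAddHaarMeasure] (hΩ : IsOpen Ω) (e : E)
    (hf : ContDiffOn ℝ 1 f Ω) : HasWeakDerivAlong Ω e f (fun z => fderiv ℝ f z e) := by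
  have hfi : LocallyIntegrableOn f Ω := hf.continuousOn.locallyIntegrableOn hΩ.measurableSet
  have hdfi : LocallyIntegrableOn (fun z => fderiv ℝ f z e) Ω :=
    ((hf.continuousOn_fderiv_of_isOpen hΩ le_rfl).clm_apply continuousOn_const).locallyIntegrableOn
      hΩ.measurableSet
  refine ⟨hfi, hdfi, fun φ hφ hc hs => ?_⟩
  have hdφ : Continuous fun z => fderiv ℝ φ z e :=
    (hφ.continuous_fderiv (by simp)).clm_apply continuous_const
  have hdc : HasCompactSupport fun z => fderiv ℝ φ z e := hc.fderiv_apply ℝ e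
  have hds : tsupport (fun z => fderiv ℝ φ z e) ⊆ Ω := (tsupport_fderiv_apply_subset ℝ e).trans hs
  rw [setIntegral_mul_eq_integral_of_tsupport_subset hds,
    setIntegral_mul_eq_integral_of_tsupport_subset hs]
  exact integral_mul_fderiv_eq_neg_fderiv_mul_of_integrable
    (integrable_mul_of_tsupport_subset hΩ hdfi hφ.continuous hc hs)
    (integrable_mul_of_tsupport_subset hΩ hfi hdφ hdc hds)
    (integrable_mul_of_tsupport_subset hΩ hfi hφ.continuous hc hs)
    (fun z hz => (hf.differentiableOn one_ne_zero).differentiableAt (hΩ.mem_nhds (hs hz)))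
    (fun z _ => hφ.differentiable (by simp) z)

theorem weakDerivAlong_ae_eq_fderiv [(volume : Measure E).IsAddHaarMeasure] (hΩ : IsOpen Ω)
    (hf : WeaklyDifferentiableAlong Ω e f) (hg : ContDiffOn ℝ 1 g Ω)
    (hfg : f =ᵐ[volume.restrict Ω] g) :
    weakDerivAlong Ω e f =ᵐ[volume.restrict Ω] fun z => fderiv ℝ g z e :=
  hf.hasWeakDerivAlong.ae_eq hΩ (hasWeakDerivAlong_fderiv hΩ e hg) hfg

end WeakDerivative

section HalfLine

theorem exists_contDiff_deriv_eq_of_nonneg {η : ℝ → ℝ} (hη : ContDiff ℝ ∞ η)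
    (hc : HasCompactSupport η) :
    ∃ θ : ℝ → ℝ, ContDiff ℝ ∞ θ ∧ HasCompactSupport θ ∧ ∀ t, 0 ≤ t → deriv θ t = η t := by
  obtain ⟨R, hR⟩ := hc.isCompact.bddAbove
  have hF : ∀ t, HasDerivAt (fun t => ∫ s in R..t, η s) (η t) t := fun t =>
    hη.continuous.integral_hasStrictDerivAt R t |>.hasDerivAt
  have hFsmooth : ContDiff ℝ ∞ fun t => ∫ s in R..t, η s := by
    refine contDiff_infty_iff_deriv.2 ⟨fun t => (hF t).differentiableAt, ?_⟩
    rwa [funext fun t => (hF t).deriv]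
  have hFzero : ∀ t, R < t → ∫ s in R..t, η s = 0 := fun t ht => by
    rw [intervalIntegral.integral_of_le ht.le]
    exact setIntegral_eq_zero_of_forall_eq_zero fun s hs =>
      image_eq_zero_of_notMem_tsupport fun h => hs.1.not_ge (hR h)
  refine ⟨fun t => Real.smoothTransition (t + 2) * ∫ s in R..t, η s,
    (Real.smoothTransition.contDiff.comp (contDiff_id.add contDiff_const)).mul hFsmooth,
    HasCompactSupport.intro (isCompact_Icc (a := -2) (b := R)) fun t ht => ?_, fun t ht => ?_⟩
  · rcases lt_or_ge t (-2) with h | h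
    · rw [Real.smoothTransition.zero_of_nonpos (by linarith), zero_mul]
    · rw [hFzero t (not_le.1 fun h' => ht ⟨h, h'⟩), mul_zero]
  · refine ((hF t).congr_of_eventuallyEq ?_).deriv
    filter_upwards [lt_mem_nhds (show -1 < t by linarith)] with s hs
    rw [Real.smoothTransition.one_of_one_le (by linarith), one_mul]

theorem exists_pos_tsupport_subset_Iio {θ : ℝ → ℝ} (hc : HasCompactSupport θ) :
    ∃ R, 0 < R ∧ tsupport θ ⊆ Iio R := by
  obtain ⟨R, hR⟩ := hc.isCompact.bddAbove
  exact ⟨max R 0 + 1, by positivity, fun t ht =>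
    ((hR ht).trans (le_max_left R 0)).trans_lt (lt_add_one _)⟩

theorem setIntegral_Ioi_mul_eq_intervalIntegral {θ : ℝ → ℝ} {R : ℝ} (hR : 0 ≤ R)
    (hθ : tsupport θ ⊆ Iio R) (f : ℝ → ℝ) :
    ∫ t in Ioi 0, f t * θ t = ∫ t in (0 : ℝ)..R, f t * θ t := by
  rw [intervalIntegral.integral_of_le hR]
  refine setIntegral_eq_of_subset_of_forall_sdiff_eq_zero measurableSet_Ioi
    Ioc_subset_Ioi_self fun t ht => ?_
  have ht' : R < t := not_le.1 fun h => ht.2 ⟨ht.1, h⟩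
  rw [image_eq_zero_of_notMem_tsupport fun h => ht'.not_gt (hθ h), mul_zero]

theorem intervalIntegrable_of_locallyIntegrableOn_Ici {b : ℝ → ℝ}
    (hb : LocallyIntegrableOn b (Ici 0)) {s t : ℝ} (hs : 0 ≤ s) (ht : 0 ≤ t) :
    IntervalIntegrable b volume s t :=
  (hb.integrableOn_compact_subset (fun _ hr => (le_min hs ht).trans hr.1)
    isCompact_uIcc).intervalIntegrable

theorem continuousOn_primitive_Ici {b : ℝ → ℝ} (hb : LocallyIntegrableOn b (Ici 0)) :
    ContinuousOn (fun t => ∫ s in (0 : ℝ)..t, b s) (Ici 0) := by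
  intro t ht
  have hT : (0 : ℝ) ≤ t + 1 := by linarith [mem_Ici.1 ht]
  have hcont := intervalIntegral.continuousOn_primitive_interval'
    (intervalIntegrable_of_locallyIntegrableOn_Ici hb le_rfl hT) left_mem_uIcc
  rw [uIcc_of_le hT] at hcont
  refine (hcont t ⟨ht, by linarith⟩).mono_of_mem_nhdsWithin ?_
  rw [← Ici_inter_Iic]
  exact inter_mem_nhdsWithin _ (Iic_mem_nhds (lt_add_one t))

theorem integral_Ioi_primitive_mul_deriv {b θ : ℝ → ℝ} (hb : LocallyIntegrableOn b (Ici 0))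
    (c : ℝ) (hθ : ContDiff ℝ 1 θ) (hc : HasCompactSupport θ) :
    ∫ t in Ioi 0, (c + ∫ s in (0 : ℝ)..t, b s) * deriv θ t =
      -(c * θ 0) - ∫ t in Ioi 0, b t * θ t := by
  obtain ⟨R, hR, hsub⟩ := exists_pos_tsupport_subset_Iio hc
  have hθR : θ R = 0 := image_eq_zero_of_notMem_tsupport fun h => lt_irrefl R (hsub h)
  have hbR : IntervalIntegrable b volume 0 R :=
    intervalIntegrable_of_locallyIntegrableOn_Ici hb le_rfl hR.le
  have hac : AbsolutelyContinuousOnInterval (fun t => c + ∫ s in (0 : ℝ)..t, b s) 0 R :=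
    (contDiff_const (c := c)).contDiffOn.absolutelyContinuousOnInterval.add
      (hbR.absolutelyContinuousOnInterval_intervalIntegral left_mem_uIcc)
  rw [setIntegral_Ioi_mul_eq_intervalIntegral hR.le ((tsupport_deriv_subset).trans hsub),
    setIntegral_Ioi_mul_eq_intervalIntegral hR.le hsub,
    hac.integral_mul_deriv_eq_deriv_mul hθ.contDiffOn.absolutelyContinuousOnInterval, hθR,
    intervalIntegral.integral_same, add_zero, mul_zero, zero_sub]
  congr 1
  refine intervalIntegral.integral_congr_ae ?_
  filter_upwards [hbR.ae_hasDerivAt_integral] with t ht htm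
  rw [((ht (uIoc_subset_uIcc htm) 0 left_mem_uIcc).const_add c).deriv]

theorem eq_zero_of_forall_integral_Ioi_mul_eq {D : ℝ → ℝ} {C : ℝ} (hD : ContinuousOn D (Ici 0))
    (h : ∀ η : ℝ → ℝ, ContDiff ℝ ∞ η → HasCompactSupport η →
      ∫ t in Ioi 0, D t * η t = C * η 0) :
    C = 0 ∧ EqOn D 0 (Ici 0) := by
  have hDzero : EqOn D 0 (Ici 0) := by
    refine Measure.eqOn_of_ae_eq (μ := volume) ?_ hD continuousOn_const
      (by rw [interior_Ici, closure_Ioi])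
    rw [← restrict_Ioi_eq_restrict_Ici]
    refine ae_eq_of_forall_integral_mul_eq isOpen_Ioi
      ((hD.mono Ioi_subset_Ici_self).locallyIntegrableOn measurableSet_Ioi)
      (locallyIntegrable_zero.locallyIntegrableOn _) fun η hη hc hs => ?_
    rw [h η hη hc, image_eq_zero_of_notMem_tsupport fun h₀ => lt_irrefl (0 : ℝ) (hs h₀)]
    simp
  refine ⟨?_, hDzero⟩
  let η : ContDiffBump (0 : ℝ) := ⟨1, 2, one_pos, one_lt_two⟩
  have hη : η 0 = 1 := η.one_of_mem_closedBall (Metric.mem_closedBall_self zero_le_one)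
  rw [← mul_one C, ← hη, ← h η η.contDiff η.hasCompactSupport]
  exact setIntegral_eq_zero_of_forall_eq_zero fun t ht => by
    rw [hDzero (Ioi_subset_Ici_self ht), Pi.zero_apply, zero_mul]

theorem integral_Ioi_mul_deriv_of_hasDerivAt {a a' θ : ℝ → ℝ} (ha : ContinuousOn a (Ici 0))
    (ha' : ContinuousOn a' (Ici 0)) (hderiv : ∀ t, 0 < t → HasDerivAt a (a' t) t)
    (hθ : ContDiff ℝ 1 θ) (hc : HasCompactSupport θ) :
    ∫ t in Ioi 0, a t * deriv θ t = -(a 0 * θ 0) - ∫ t in Ioi 0, a' t * θ t := by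
  have ha'i : LocallyIntegrableOn a' (Ici 0) := ha'.locallyIntegrableOn measurableSet_Ici
  rw [← integral_Ioi_primitive_mul_deriv ha'i (a 0) hθ hc]
  refine setIntegral_congr_fun measurableSet_Ioi fun t ht => ?_
  rw [intervalIntegral.integral_eq_sub_of_hasDerivAt_of_le (le_of_lt ht)
    (ha.mono Icc_subset_Ici_self) (fun s hs => hderiv s hs.1)
    (intervalIntegrable_of_locallyIntegrableOn_Ici ha'i le_rfl (le_of_lt ht)), add_sub_cancel]

theorem integrableOn_Ioi_mul {f θ : ℝ → ℝ} (hf : LocallyIntegrableOn f (Ici 0))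
    (hθ : Continuous θ) (hc : HasCompactSupport θ) : IntegrableOn (fun t => f t * θ t) (Ioi 0) :=
  (integrableOn_mul_of_isCompact hf measurableSet_Ici (hc.isCompact.inter_left isClosed_Ici)
    inter_subset_left hθ.continuousOn fun _ ht => image_eq_zero_of_notMem_tsupport fun hm =>
      ht.2 ⟨ht.1, hm⟩).mono_set Ioi_subset_Ici_self

theorem deriv_eq_of_weak_second_deriv {a a' b : ℝ → ℝ} {V₀ V₁ : ℝ}
    (ha : ContinuousOn a (Ici 0)) (ha' : ContinuousOn a' (Ici 0))
    (hderiv : ∀ t, 0 < t → HasDerivAt a (a' t) t) (hb : LocallyIntegrableOn b (Ici 0))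
    (h : ∀ θ : ℝ → ℝ, ContDiff ℝ ∞ θ → HasCompactSupport θ →
      (∫ t in Ioi 0, a t * deriv (deriv θ) t) + ∫ t in Ioi 0, b t * θ t =
        V₁ * θ 0 - V₀ * deriv θ 0) :
    a 0 = V₀ ∧ ∀ t, 0 ≤ t → a' t = V₁ - ∫ s in (0 : ℝ)..t, b s := by
  let B : ℝ → ℝ := fun t => -V₁ + ∫ s in (0 : ℝ)..t, b s
  have hB : ContinuousOn B (Ici 0) := continuousOn_const.add (continuousOn_primitive_Ici hb)
  have htest : ∀ η : ℝ → ℝ, ContDiff ℝ ∞ η → HasCompactSupport η →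
      ∫ t in Ioi 0, (a' t + B t) * η t = (V₀ - a 0) * η 0 := fun η hη hc => by
    obtain ⟨θ, hθ, hθc, hθη⟩ := exists_contDiff_deriv_eq_of_nonneg hη hc
    have hdθ : ContDiff ℝ ∞ (deriv θ) := (contDiff_infty_iff_deriv.1 hθ).2
    have hbθ := integral_Ioi_primitive_mul_deriv hb (-V₁) (hθ.of_le (by simp)) hθc
    have haθ := integral_Ioi_mul_deriv_of_hasDerivAt ha ha' hderiv (hdθ.of_le (by simp)) hθc.deriv
    calc ∫ t in Ioi 0, (a' t + B t) * η t
        = ∫ t in Ioi 0, (a' t * deriv θ t + B t * deriv θ t) :=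
          setIntegral_congr_fun measurableSet_Ioi fun t ht => by
            simp only [hθη t (le_of_lt ht), add_mul]
      _ = (∫ t in Ioi 0, a' t * deriv θ t) + ∫ t in Ioi 0, B t * deriv θ t :=
          integral_add
            (integrableOn_Ioi_mul (ha'.locallyIntegrableOn measurableSet_Ici) hdθ.continuous
              hθc.deriv)
            (integrableOn_Ioi_mul (hB.locallyIntegrableOn measurableSet_Ici) hdθ.continuous
              hθc.deriv)
      _ = (V₀ - a 0) * η 0 := by
          rw [← hθη 0 le_rfl]
          linarith [h θ hθ hθc]
  obtain ⟨hV₀, hzero⟩ := eq_zero_of_forall_integral_Ioi_mul_eq (ha'.add hB) htest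
  refine ⟨(sub_eq_zero.1 hV₀).symm, fun t ht => ?_⟩
  have hsum : a' t + (-V₁ + ∫ s in (0 : ℝ)..t, b s) = 0 := hzero ht
  linarith

end HalfLine

section Strip

variable {L : ℝ} {F : ℝ × ℝ → ℝ}

theorem isOpen_strip (L : ℝ) : IsOpen (strip L) := isOpen_Ioi.prod isOpen_Ioo

theorem isClosed_closedStrip (L : ℝ) : IsClosed (closedStrip L) := isClosed_Ici.prod isClosed_Icc

theorem strip_subset_closedStrip (L : ℝ) : strip L ⊆ closedStrip L :=
  prod_mono Ioi_subset_Ici_self Ioo_subset_Icc_self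

theorem uniqueDiffOn_closedStrip (hL : 0 < L) : UniqueDiffOn ℝ (closedStrip L) :=
  (uniqueDiffOn_Ici 0).prod (uniqueDiffOn_Icc hL)

theorem volume_restrict_prod (I J : Set ℝ) : (volume : Measure (ℝ × ℝ)).restrict (I ×ˢ J) =
    (volume.restrict I).prod (volume.restrict J) := by
  rw [Measure.volume_eq_prod, Measure.prod_restrict]

theorem volume_restrict_prod_Icc (I : Set ℝ) (L : ℝ) :
    (volume : Measure (ℝ × ℝ)).restrict (I ×ˢ Icc 0 L) =
      (volume.restrict I).prod (volume.restrict (Ioo 0 L)) := by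
  rw [volume_restrict_prod, restrict_Ioo_eq_restrict_Icc]

theorem continuousOn_section (hF : ContinuousOn F (closedStrip L)) {t : ℝ} (ht : 0 ≤ t) :
    ContinuousOn (fun x => F (t, x)) (Icc 0 L) :=
  hF.comp (by fun_prop) fun _ hx => mk_mem_prod ht hx

theorem integrableOn_section (hF : ContinuousOn F (closedStrip L)) {t : ℝ} (ht : 0 ≤ t) :
    IntegrableOn (fun x => F (t, x)) (Ioo 0 L) :=
  (continuousOn_section hF ht).integrableOn_Icc.mono_set Ioo_subset_Icc_self

theorem continuousOn_time_section (hF : ContinuousOn F (closedStrip L)) {x : ℝ}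
    (hx : x ∈ Icc 0 L) : ContinuousOn (fun t => F (t, x)) (Ici 0) :=
  hF.comp (by fun_prop) fun _ ht => mk_mem_prod ht hx

theorem continuousOn_integral_section (hL : 0 ≤ L) (hF : ContinuousOn F (closedStrip L)) :
    ContinuousOn (fun t => ∫ x in Ioo 0 L, F (t, x)) (Ici 0) := by
  have hclamp : Continuous (Function.uncurry fun t x : ℝ => F (max t 0, max 0 (min x L))) :=
    hF.comp_continuous (f := fun z : ℝ × ℝ => (max z.1 0, max 0 (min z.2 L))) (by fun_prop)
      fun z => ⟨mem_Ici.2 (le_max_right _ _), le_max_left _ _, max_le hL (min_le_right _ _)⟩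
  refine (continuous_parametric_integral_of_continuous (μ := volume) hclamp
    (isCompact_Icc (a := (0 : ℝ)) (b := L))).continuousOn.congr fun t ht => ?_
  simp only [integral_Icc_eq_integral_Ioo]
  refine setIntegral_congr_fun measurableSet_Ioo fun x hx => ?_
  simp only [max_eq_left (mem_Ici.1 ht), min_eq_left hx.2.le, max_eq_right hx.1.le]

theorem hasDerivAt_integral_section {F' : ℝ × ℝ → ℝ} (hF : ContinuousOn F (closedStrip L))
    (hF' : ContinuousOn F' (closedStrip L))
    (hderiv : ∀ t, 0 < t → ∀ x ∈ Ioo 0 L, HasDerivAt (fun s => F (s, x)) (F' (t, x)) t) {t : ℝ}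
    (ht : 0 < t) :
    HasDerivAt (fun s => ∫ x in Ioo 0 L, F (s, x)) (∫ x in Ioo 0 L, F' (t, x)) t := by
  obtain ⟨K, hK⟩ := (isCompact_Icc.prod isCompact_Icc).exists_bound_of_continuousOn
    (hF'.mono (prod_mono_left (Icc_subset_Ici_self : Icc 0 (t + 1) ⊆ Ici 0)))
  refine (hasDerivAt_integral_of_dominated_loc_of_deriv_le
    (F := fun s x => F (s, x)) (F' := fun s x => F' (s, x)) (bound := fun _ => K)
    (Ioo_mem_nhds ht (lt_add_one t)) ?_ (integrableOn_section hF ht.le)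
    (integrableOn_section hF' ht.le).aestronglyMeasurable ?_ (integrable_const K) ?_).2
  · filter_upwards [lt_mem_nhds ht] with s hs
    exact (integrableOn_section hF hs.le).aestronglyMeasurable
  · filter_upwards [ae_restrict_mem measurableSet_Ioo] with x hx s hs
    exact hK (s, x) ⟨⟨hs.1.le, hs.2.le⟩, hx.1.le, hx.2.le⟩
  · filter_upwards [ae_restrict_mem measurableSet_Ioo] with x hx s hs
    exact hderiv s hs.1 x hx

theorem eventually_nhdsGE_forall_section (hF : ContinuousOn F (closedStrip L)) {U : Set ℝ}
    (hU : IsOpen U) {t₀ : ℝ} (ht₀ : 0 ≤ t₀) (h : ∀ x ∈ Icc 0 L, F (t₀, x) ∈ U) :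
    ∀ᶠ t in 𝓝[≥] t₀, ∀ x ∈ Icc 0 L, F (t, x) ∈ U := by
  obtain ⟨V, hV, hVU⟩ := continuousOn_iff'.1 hF U hU
  have hnhds : ∀ x ∈ Icc 0 L, ∀ᶠ z : ℝ × ℝ in 𝓝 (t₀, x), z ∈ closedStrip L → F z ∈ U := by
    intro x hx
    filter_upwards [hV.mem_nhds (hVU.subset ⟨h x hx, ht₀, hx⟩).1] with z hz hzs
    exact (hVU.superset ⟨hz, hzs⟩).1
  have hall := isCompact_Icc.eventually_forall_of_forall_eventually
    (P := fun t x => (t, x) ∈ closedStrip L → F (t, x) ∈ U) hnhds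
  filter_upwards [nhdsWithin_le_nhds hall, self_mem_nhdsWithin] with t ht htt₀ x hx
  exact ht x hx ⟨ht₀.trans htt₀, hx⟩

theorem isCompact_setOf_exists_section_mem (hF : ContinuousOn F (closedStrip L)) {C : Set ℝ}
    (hC : IsClosed C) {a : ℝ} (ha : 0 ≤ a) (b : ℝ) :
    IsCompact {t | t ∈ Icc a b ∧ ∃ x ∈ Icc 0 L, F (t, x) ∈ C} := by
  have hK : IsCompact (Icc a b ×ˢ Icc 0 L) := isCompact_Icc.prod isCompact_Icc
  have hpre : IsCompact (Icc a b ×ˢ Icc 0 L ∩ F ⁻¹' C) :=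
    hK.of_isClosed_subset ((hF.mono (prod_mono_left fun t ht =>
      ha.trans ht.1)).preimage_isClosed_of_isClosed hK.isClosed hC) inter_subset_left
  convert hpre.image continuous_fst using 1
  ext t
  simp only [mem_ofPred_eq, mem_image, mem_inter_iff, mem_prod, mem_preimage, Prod.exists,
    exists_and_right, exists_eq_right]
  tauto

end Strip

section LocallyIntegrable

variable {L : ℝ} {F : ℝ × ℝ → ℝ}

theorem locallyIntegrableOn_integral_section (hF : LocallyIntegrableOn F (closedStrip L)) :
    LocallyIntegrableOn (fun t => ∫ x in Ioo 0 L, F (t, x)) (Ici 0) := by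
  refine (locallyIntegrableOn_iff isClosed_Ici.isLocallyClosed).2 fun K hK hKc => ?_
  have hFK := hF.integrableOn_compact_subset (prod_mono_left hK)
    (hKc.prod (isCompact_Icc (a := (0 : ℝ)) (b := L)))
  rw [IntegrableOn, volume_restrict_prod_Icc] at hFK
  exact hFK.integral_prod_left

theorem integrableOn_strip_mul (hF : LocallyIntegrableOn F (closedStrip L)) {θ : ℝ → ℝ}
    (hθ : Continuous θ) (hc : HasCompactSupport θ) :
    IntegrableOn (fun z => F z * θ z.1) (strip L) := by
  refine (integrableOn_mul_of_isCompact hF (isClosed_closedStrip L).measurableSet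
    ((hc.isCompact.inter_left isClosed_Ici).prod isCompact_Icc) (prod_mono_left inter_subset_left)
    (hθ.comp continuous_fst).continuousOn fun z hz => ?_).mono_set (strip_subset_closedStrip L)
  exact image_eq_zero_of_notMem_tsupport (f := θ) fun h => hz.2 ⟨⟨hz.1.1, h⟩, hz.1.2⟩

theorem setIntegral_strip_mul (hF : LocallyIntegrableOn F (closedStrip L)) {θ : ℝ → ℝ}
    (hθ : Continuous θ) (hc : HasCompactSupport θ) :
    ∫ z in strip L, F z * θ z.1 = ∫ t in Ioi 0, (∫ x in Ioo 0 L, F (t, x)) * θ t := by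
  have hint := integrableOn_strip_mul hF hθ hc
  rw [IntegrableOn, strip, volume_restrict_prod] at hint
  rw [strip, volume_restrict_prod, integral_prod _ hint]
  simp only [integral_mul_const]

theorem MemLinftyL2.locallyIntegrableOn (hF : MemLinftyL2 (Ioi 0) L F) :
    LocallyIntegrableOn F (closedStrip L) := by
  obtain ⟨hm, C, hC⟩ := hF
  refine (locallyIntegrableOn_iff (isClosed_closedStrip L).isLocallyClosed).2 fun K hK hKc => ?_
  obtain ⟨T, hT⟩ := (hKc.image continuous_fst).bddAbove
  have hKT : K ⊆ Icc 0 T ×ˢ Icc 0 L := fun z hz =>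
    ⟨⟨(hK hz).1, hT (mem_image_of_mem _ hz)⟩, (hK hz).2⟩
  refine IntegrableOn.mono_set ?_ hKT
  have hsub : volume.restrict (Icc 0 T) ≤ volume.restrict (Ioi (0 : ℝ)) := by
    rw [← restrict_Ioc_eq_restrict_Icc]
    exact Measure.restrict_mono Ioc_subset_Ioi_self le_rfl
  rw [volume_restrict_prod] at hm
  have hmT := hm.mono_measure (Measure.prod_mono hsub le_rfl)
  rw [IntegrableOn, volume_restrict_prod_Icc]
  refine ⟨hmT, ?_⟩
  let B : ENNReal := C * volume.restrict (Ioo 0 L) univ ^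
    (1 / (1 : ENNReal).toReal - 1 / (2 : ENNReal).toReal)
  have hB : B < ⊤ := ENNReal.mul_lt_top ENNReal.coe_lt_top
    (ENNReal.rpow_lt_top_of_nonneg (by norm_num) (by simp))
  rw [hasFiniteIntegral_iff_enorm, lintegral_prod _ hmT.enorm]
  calc ∫⁻ t in Icc 0 T, ∫⁻ x in Ioo 0 L, ‖F (t, x)‖ₑ ≤ ∫⁻ _ in Icc 0 T, B := by
        refine lintegral_mono_ae ?_
        filter_upwards [hmT.prodMk_left, ae_mono hsub hC] with t hmt hCt
        rw [← eLpNorm_one_eq_lintegral_enorm]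
        exact (eLpNorm_le_eLpNorm_mul_rpow_measure_univ (q := 2) (by norm_num) hmt).trans
          (mul_le_mul_left hCt _)
    _ < ⊤ := by
        rw [lintegral_const]
        exact ENNReal.mul_lt_top hB (by simp)

theorem locallyIntegrableOn_closedStrip_of_ae_bound {C : ℝ}
    (hm : AEStronglyMeasurable F (volume.restrict (strip L)))
    (hC : ∀ᵐ z ∂volume.restrict (strip L), ‖F z‖ ≤ C) :
    LocallyIntegrableOn F (closedStrip L) := by
  refine (locallyIntegrableOn_iff (isClosed_closedStrip L).isLocallyClosed).2 fun K hK hKc => ?_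
  have hsub : volume.restrict K ≤ volume.restrict (strip L) := by
    refine (Measure.restrict_mono hK le_rfl).trans_eq ?_
    rw [closedStrip, volume_restrict_prod_Icc, strip, volume_restrict_prod,
      restrict_Ioi_eq_restrict_Ici]
  exact IntegrableOn.of_bound hKc.measure_lt_top (hm.mono_measure hsub) C (ae_mono hsub hC)

end LocallyIntegrable

section TimeDeriv

variable {L : ℝ} {u : ℝ × ℝ → ℝ}

/-- The time derivative on `[0, ∞) × [0, L]` of a function that is `C¹` up to the boundary. -/
noncomputable def timeDeriv (L : ℝ) (u : ℝ × ℝ → ℝ) (z : ℝ × ℝ) : ℝ :=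
  fderivWithin ℝ u (closedStrip L) z (1, 0)

theorem continuousOn_timeDeriv (hL : 0 < L) (hu : ContDiffOn ℝ 1 u (closedStrip L)) :
    ContinuousOn (timeDeriv L u) (closedStrip L) :=
  (hu.continuousOn_fderivWithin (uniqueDiffOn_closedStrip hL) le_rfl).clm_apply continuousOn_const

theorem hasDerivAt_timeDeriv (hu : ContDiffOn ℝ 1 u (closedStrip L)) {t x : ℝ} (ht : 0 < t)
    (hx : x ∈ Icc 0 L) : HasDerivAt (fun s => u (s, x)) (timeDeriv L u (t, x)) t := by
  have hfderiv : HasFDerivWithinAt u (fderivWithin ℝ u (closedStrip L) (t, x)) (closedStrip L)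
      (t, x) := (hu.differentiableOn one_ne_zero (t, x) ⟨ht.le, hx⟩).hasFDerivWithinAt
  have hpath : HasDerivWithinAt (fun s : ℝ => (s, x)) ((1, 0) : ℝ × ℝ) (Ici 0) t :=
    ((hasDerivAt_id t).prodMk (hasDerivAt_const t x)).hasDerivWithinAt
  exact (hfderiv.comp_hasDerivWithinAt t hpath fun s hs => mk_mem_prod hs hx).hasDerivAt
    (Ici_mem_nhds ht)

theorem intervalIntegrable_timeDeriv (hL : 0 < L) (hu : ContDiffOn ℝ 1 u (closedStrip L))
    {a b x : ℝ} (ha : 0 ≤ a) (hab : a ≤ b) (hx : x ∈ Icc 0 L) :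
    IntervalIntegrable (fun s => timeDeriv L u (s, x)) volume a b :=
  ((continuousOn_time_section (continuousOn_timeDeriv hL hu) hx).mono
    fun _ hs => ha.trans hs.1).intervalIntegrable_of_Icc hab

theorem integral_timeDeriv_eq_sub (hL : 0 < L) (hu : ContDiffOn ℝ 1 u (closedStrip L)) {a b x : ℝ}
    (ha : 0 ≤ a) (hab : a ≤ b) (hx : x ∈ Icc 0 L) :
    ∫ s in a..b, timeDeriv L u (s, x) = u (b, x) - u (a, x) :=
  intervalIntegral.integral_eq_sub_of_hasDerivAt_of_le hab
    ((continuousOn_time_section hu.continuousOn hx).mono fun _ hs => ha.trans hs.1)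
    (fun _ hs => hasDerivAt_timeDeriv hu (ha.trans_lt hs.1) hx)
    (intervalIntegrable_timeDeriv hL hu ha hab hx)

theorem sub_eq_sub_of_timeDeriv_eq (hL : 0 < L) (hu : ContDiffOn ℝ 1 u (closedStrip L))
    {a b x y : ℝ} (ha : 0 ≤ a) (hab : a ≤ b) (hx : x ∈ Icc 0 L) (hy : y ∈ Icc 0 L)
    (h : ∀ s ∈ Ioo a b, timeDeriv L u (s, x) = timeDeriv L u (s, y)) :
    u (b, x) - u (a, x) = u (b, y) - u (a, y) := by
  rw [← integral_timeDeriv_eq_sub hL hu ha hab hx, ← integral_timeDeriv_eq_sub hL hu ha hab hy]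
  exact intervalIntegral.integral_congr_Ioo_of_le hab h

theorem eventually_nhdsGT_forall_mul_lt (hL : 0 < L) (hu : ContDiffOn ℝ 1 u (closedStrip L))
    {t₀ c : ℝ} (ht₀ : 0 ≤ t₀) (h : ∀ x ∈ Icc 0 L, 0 < c * timeDeriv L u (t₀, x)) :
    ∀ᶠ t in 𝓝[>] t₀, ∀ x ∈ Icc 0 L, c * u (t₀, x) < c * u (t, x) := by
  have hnear := eventually_nhdsGE_forall_section
    (continuousOn_const.mul (continuousOn_timeDeriv hL hu)) isOpen_Ioi ht₀ h
  obtain ⟨T, hT, hpos⟩ := mem_nhdsGT_iff_exists_Ioo_subset.1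
    (nhdsWithin_mono t₀ Ioi_subset_Ici_self hnear)
  filter_upwards [Ioo_mem_nhdsGT hT] with t ht x hx
  have hint := intervalIntegral.intervalIntegral_pos_of_pos_on
    ((intervalIntegrable_timeDeriv hL hu ht₀ ht.1.le hx).const_mul c)
    (fun s hs => hpos ⟨hs.1, hs.2.trans ht.2⟩ x hx) ht.1
  rw [intervalIntegral.integral_const_mul,
    integral_timeDeriv_eq_sub hL hu ht₀ ht.1.le hx] at hint
  linarith

theorem weakDt_ae_eq_timeDeriv (hu : ContDiffOn ℝ 1 u (closedStrip L))
    (hd : WeaklyDifferentiableAlong (strip L) (1, 0) u) :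
    weakDt L u =ᵐ[volume.restrict (strip L)] timeDeriv L u := by
  have hopen := isOpen_strip L
  refine (weakDerivAlong_ae_eq_fderiv hopen hd (hu.mono (strip_subset_closedStrip L))
    (ae_eq_refl _)).trans ?_
  filter_upwards [ae_restrict_mem hopen.measurableSet] with z hz
  rw [timeDeriv, fderivWithin_of_mem_nhds
    (mem_of_superset (hopen.mem_nhds hz) (strip_subset_closedStrip L))]

end TimeDeriv

section Average

theorem sq_average_le_average_sq {α : Type*} [MeasurableSpace α] {μ : Measure α}
    [IsFiniteMeasure μ] [NeZero μ] {f : α → ℝ} (hf : Integrable f μ)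
    (hf2 : Integrable (fun x => f x ^ 2) μ) : (⨍ x, f x ∂μ) ^ 2 ≤ ⨍ x, f x ^ 2 ∂μ :=
  (even_two.convexOn_pow (𝕜 := ℝ)).map_average_le (continuous_pow 2).continuousOn isClosed_univ
    (by simp) hf hf2

theorem ae_eq_average_of_average_sq_le {α : Type*} [MeasurableSpace α] {μ : Measure α}
    [IsFiniteMeasure μ] {f : α → ℝ} (hf : Integrable f μ)
    (hf2 : Integrable (fun x => f x ^ 2) μ) (h : ⨍ x, f x ^ 2 ∂μ ≤ (⨍ x, f x ∂μ) ^ 2) :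
    f =ᵐ[μ] fun _ => ⨍ x, f x ∂μ :=
  ((even_two.strictConvexOn_pow two_ne_zero).ae_eq_const_or_map_average_lt
    (continuous_pow 2).continuousOn isClosed_univ (by simp) hf hf2).resolve_right h.not_gt

end Average

section SpatialMean

variable {L t : ℝ} {F : ℝ × ℝ → ℝ}

/-- The mean over the beam `(0, L)` of a space-time function, as a function of time. -/
noncomputable def spatialMean (L : ℝ) (F : ℝ × ℝ → ℝ) (t : ℝ) : ℝ := ⨍ x in Ioo 0 L, F (t, x)

theorem spatialMean_eq (hL : 0 ≤ L) (F : ℝ × ℝ → ℝ) (t : ℝ) :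
    spatialMean L F t = L⁻¹ * ∫ x in Ioo 0 L, F (t, x) := by
  rw [spatialMean, setAverage_eq, Real.volume_real_Ioo_of_le hL, sub_zero, smul_eq_mul]

theorem spatialMean_eq_of_forall (hL : 0 < L) {c : ℝ} (h : ∀ x ∈ Icc 0 L, F (t, x) = c) :
    spatialMean L F t = c := by
  rw [spatialMean, setAverage_congr_fun measurableSet_Ioo
    (Eventually.of_forall fun x hx => h x (Ioo_subset_Icc_self hx)),
    setAverage_const (by simpa using hL) (by simp)]

theorem spatialMean_eq_const_mul_add {G : ℝ × ℝ → ℝ} {c d : ℝ} (hL : 0 < L)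
    (hG : ContinuousOn G (closedStrip L)) (ht : 0 ≤ t)
    (h : ∀ x ∈ Icc 0 L, F (t, x) = c * G (t, x) + d) :
    spatialMean L F t = c * spatialMean L G t + d := by
  have hcongr : ∫ x in Ioo 0 L, F (t, x) = ∫ x in Ioo 0 L, (c * G (t, x) + d) :=
    setIntegral_congr_fun measurableSet_Ioo fun x hx => h x (Ioo_subset_Icc_self hx)
  rw [spatialMean_eq hL.le, spatialMean_eq hL.le, hcongr,
    integral_add ((integrableOn_section hG ht).const_mul c) (integrable_const d),
    integral_const_mul, setIntegral_const, Real.volume_real_Ioo_of_le hL.le, sub_zero, smul_eq_mul,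
    mul_add, inv_mul_cancel_left₀ hL.ne', mul_left_comm]

theorem continuousOn_spatialMean (hL : 0 ≤ L) (hF : ContinuousOn F (closedStrip L)) :
    ContinuousOn (spatialMean L F) (Ici 0) :=
  ((continuousOn_integral_section hL hF).const_mul L⁻¹).congr fun t _ => spatialMean_eq hL F t

theorem hasDerivAt_spatialMean (hL : 0 < L) (hF : ContDiffOn ℝ 1 F (closedStrip L)) (ht : 0 < t) :
    HasDerivAt (spatialMean L F) (spatialMean L (timeDeriv L F) t) t := by
  simp only [funext (spatialMean_eq hL.le _)]
  exact (hasDerivAt_integral_section hF.continuousOn (continuousOn_timeDeriv hL hF)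
    (fun t ht x hx => hasDerivAt_timeDeriv hF ht (Ioo_subset_Icc_self hx)) ht).const_mul L⁻¹

theorem sq_spatialMean_le (hL : 0 < L) (hF : ContinuousOn F (closedStrip L)) (ht : 0 ≤ t) :
    spatialMean L F t ^ 2 ≤ spatialMean L (fun z => F z ^ 2) t := by
  have : NeZero (volume.restrict (Ioo 0 L)) := ⟨by simpa using hL⟩
  exact sq_average_le_average_sq (integrableOn_section hF ht) (integrableOn_section (hF.pow 2) ht)

theorem eq_spatialMean_of_spatialMean_sq_le (hL : 0 < L) (hF : ContinuousOn F (closedStrip L))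
    (ht : 0 ≤ t) (h : spatialMean L (fun z => F z ^ 2) t ≤ spatialMean L F t ^ 2) :
    ∀ x ∈ Icc 0 L, F (t, x) = spatialMean L F t := by
  refine Measure.eqOn_Icc_of_ae_eq volume hL.ne ?_ (continuousOn_section hF ht) continuousOn_const
  rw [← restrict_Ioo_eq_restrict_Icc]
  exact ae_eq_average_of_average_sq_le (integrableOn_section hF ht)
    (integrableOn_section (hF.pow 2) ht) h

end SpatialMean

section Potential

variable {κ₂ s ξ : ℝ}

theorem potential_of_abs_le_one (hs : |s| ≤ 1) : potential κ₂ s = κ₂ ^ 2 * s ^ 2 / 2 := if_pos hs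

theorem potential_of_one_le_abs (hs : 1 ≤ |s|) : potential κ₂ s = κ₂ ^ 2 / 2 := by
  rcases hs.eq_or_lt with h | h
  · rw [potential_of_abs_le_one h.ge, ← sq_abs s, ← h, one_pow, mul_one]
  · exact if_neg h.not_ge

theorem potential_eventuallyEq_of_abs_lt_one (hs : |s| < 1) :
    potential κ₂ =ᶠ[𝓝 s] fun r => κ₂ ^ 2 * r ^ 2 / 2 := by
  filter_upwards [continuous_abs.continuousAt.eventually_lt_const hs] with r hr
  exact potential_of_abs_le_one hr.le

theorem potential_eventuallyEq_of_one_lt_abs (hs : 1 < |s|) :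
    potential κ₂ =ᶠ[𝓝 s] fun _ => κ₂ ^ 2 / 2 := by
  filter_upwards [continuous_abs.continuousAt.eventually_const_lt hs] with r hr
  exact potential_of_one_le_abs hr.le

theorem potential_eq_min (κ₂ s : ℝ) : potential κ₂ s = κ₂ ^ 2 / 2 * (min |s| 1) ^ 2 := by
  rcases le_total |s| 1 with h | h
  · rw [potential_of_abs_le_one h, min_eq_left h, sq_abs]; ring
  · rw [potential_of_one_le_abs h, min_eq_right h]; ring

theorem lipschitzWith_potential (κ₂ : ℝ) :
    LipschitzWith (Real.toNNReal (κ₂ ^ 2)) (potential κ₂) := by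
  refine LipschitzWith.of_dist_le_mul fun a b => ?_
  rw [Real.dist_eq, Real.dist_eq, Real.coe_toNNReal _ (sq_nonneg _), potential_eq_min,
    potential_eq_min]
  have hdiff : |min |a| 1 - min |b| 1| ≤ |a - b| :=
    (abs_min_sub_min_le_max |a| 1 |b| 1).trans (by
      rw [sub_self, abs_zero, max_eq_left (abs_nonneg _)]
      exact abs_abs_sub_abs_le _ _)
  have hsum : |min |a| 1 + min |b| 1| ≤ 2 := by
    rw [abs_of_nonneg (by positivity)]
    linarith [min_le_right |a| 1, min_le_right |b| 1]
  calc |κ₂ ^ 2 / 2 * min |a| 1 ^ 2 - κ₂ ^ 2 / 2 * min |b| 1 ^ 2|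
      = κ₂ ^ 2 / 2 * (|min |a| 1 - min |b| 1| * |min |a| 1 + min |b| 1|) := by
        rw [← abs_mul, ← mul_sub, abs_mul, abs_of_nonneg (by positivity : 0 ≤ κ₂ ^ 2 / 2),
          sq_sub_sq, mul_comm (_ - _)]
    _ ≤ κ₂ ^ 2 / 2 * (|a - b| * 2) := by gcongr
    _ = κ₂ ^ 2 * |a - b| := by ring

theorem continuous_potential (κ₂ : ℝ) : Continuous (potential κ₂) :=
  (lipschitzWith_potential κ₂).continuous

theorem subdifferential_subset_closedBall_of_lipschitzWith {f : ℝ → ℝ} {C : ℝ≥0}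
    (hf : LipschitzWith C f) (s : ℝ) : subdifferential f s ⊆ Metric.closedBall 0 C := by
  refine convexHull_min ?_ (convex_closedBall _ _)
  rintro η ⟨y, -, -, hy⟩
  refine Metric.isClosed_closedBall.mem_of_tendsto hy (Eventually.of_forall fun n => ?_)
  exact mem_closedBall_zero_iff.2 (norm_deriv_le_of_lipschitz hf)

theorem subdifferential_subset_singleton {f f' : ℝ → ℝ} (h : ∀ᶠ y in 𝓝 s, HasDerivAt f (f' y) y)
    (hf' : ContinuousAt f' s) : subdifferential f s ⊆ {f' s} := by
  refine convexHull_min ?_ (convex_singleton _)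
  rintro η ⟨y, hy, -, hη⟩
  refine tendsto_nhds_unique hη ((hf'.tendsto.comp hy).congr' ?_)
  filter_upwards [hy.eventually h] with n hn
  exact hn.deriv.symm

theorem eq_mul_of_mem_subdifferential {f : ℝ → ℝ} {k d : ℝ}
    (hf : f =ᶠ[𝓝 s] fun r => k * r ^ 2 / 2 + d) (hξ : ξ ∈ subdifferential f s) : ξ = k * s := by
  refine subdifferential_subset_singleton (f' := fun r => k * r) ?_ (by fun_prop) hξ
  filter_upwards [hf.eventuallyEq_nhds] with r hr
  have hquad : HasDerivAt (fun r : ℝ => k * r ^ 2 / 2 + d) (k * (2 * r) / 2) r := by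
    simpa using (((hasDerivAt_pow 2 r).const_mul k).div_const 2).add_const d
  exact (hquad.congr_of_eventuallyEq hr).congr_deriv (by ring)

end Potential

section SeparatedTest

variable {κ₁ L : ℝ} {v₀ v₁ θ ψ : ℝ → ℝ} {u h : ℝ × ℝ → ℝ}

theorem hasFDerivAt_mul_fst_snd (hθ : Differentiable ℝ θ) (hψ : Differentiable ℝ ψ) (z : ℝ × ℝ) :
    HasFDerivAt (fun z : ℝ × ℝ => θ z.1 * ψ z.2)
      (θ z.1 • (deriv ψ z.2 • ContinuousLinearMap.snd ℝ ℝ ℝ) +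
        ψ z.2 • (deriv θ z.1 • ContinuousLinearMap.fst ℝ ℝ ℝ)) z :=
  ((hθ z.1).hasDerivAt.comp_hasFDerivAt z hasFDerivAt_fst).fun_mul
    ((hψ z.2).hasDerivAt.comp_hasFDerivAt z hasFDerivAt_snd)

theorem partialT_mul_fst_snd (hθ : Differentiable ℝ θ) (hψ : Differentiable ℝ ψ) :
    partialT (fun z => θ z.1 * ψ z.2) = fun z => deriv θ z.1 * ψ z.2 := by
  ext z
  simp [partialT, (hasFDerivAt_mul_fst_snd hθ hψ z).fderiv, mul_comm]

theorem partialX_mul_fst_snd (hθ : Differentiable ℝ θ) (hψ : Differentiable ℝ ψ) :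
    partialX (fun z => θ z.1 * ψ z.2) = fun z => θ z.1 * deriv ψ z.2 := by
  ext z
  simp [partialX, (hasFDerivAt_mul_fst_snd hθ hψ z).fderiv]

theorem hasCompactSupport_mul_fst_snd (hθ : HasCompactSupport θ) (hψ : HasCompactSupport ψ) :
    HasCompactSupport fun z : ℝ × ℝ => θ z.1 * ψ z.2 := by
  refine HasCompactSupport.intro (hθ.isCompact.prod hψ.isCompact) fun z hz => ?_
  rcases not_and_or.1 hz with h | h <;> simp [image_eq_zero_of_notMem_tsupport h]

/-- The density of the pairing of the bending and adhesive forces with a space profile `ψ`, once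
the bending term `κ₁² ∂ₓₓ²(∂ₓₓ u)` has been integrated by parts twice onto `ψ`. -/
noncomputable def forceDensity (κ₁ L : ℝ) (u h : ℝ × ℝ → ℝ) (ψ : ℝ → ℝ) (z : ℝ × ℝ) : ℝ :=
  κ₁ ^ 2 * weakDxx L u z * deriv (deriv ψ) z.2 + h z * ψ z.2

theorem locallyIntegrableOn_mul_snd {F : ℝ × ℝ → ℝ} (hF : LocallyIntegrableOn F (closedStrip L))
    (hψ : Continuous ψ) : LocallyIntegrableOn (fun z => F z * ψ z.2) (closedStrip L) :=
  hF.mul_continuousOn (hψ.comp continuous_snd).continuousOn (isClosed_closedStrip L).isLocallyClosed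

theorem locallyIntegrableOn_forceDensity
    (hw : LocallyIntegrableOn (weakDxx L u) (closedStrip L))
    (hh : LocallyIntegrableOn h (closedStrip L)) (hψ : ContDiff ℝ ∞ ψ) :
    LocallyIntegrableOn (forceDensity κ₁ L u h ψ) (closedStrip L) := by
  have hψ'' : Continuous (deriv (deriv ψ)) :=
    (contDiff_infty_iff_deriv.1 hψ).2.continuous_deriv (by simp)
  exact (locallyIntegrableOn_mul_snd (hw.smul (κ₁ ^ 2)) hψ'').add
    (locallyIntegrableOn_mul_snd hh hψ.continuous)

theorem IsWeakSolution.apply_mul_fst_snd (hweak : IsWeakSolution κ₁ L v₀ v₁ u h)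
    (hu : ContinuousOn u (closedStrip L)) (hw : LocallyIntegrableOn (weakDxx L u) (closedStrip L))
    (hh : LocallyIntegrableOn h (closedStrip L))
    (hψ : ContDiff ℝ ∞ ψ) (hψc : HasCompactSupport ψ) (hψ0 : deriv ψ 0 = 0) (hψL : deriv ψ L = 0)
    (hθ : ContDiff ℝ ∞ θ) (hθc : HasCompactSupport θ) :
    (∫ t in Ioi 0, (∫ x in Ioo 0 L, u (t, x) * ψ x) * deriv (deriv θ) t) +
      ∫ t in Ioi 0, (∫ x in Ioo 0 L, forceDensity κ₁ L u h ψ (t, x)) * θ t =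
      (∫ x in Ioo 0 L, v₁ x * ψ x) * θ 0 - (∫ x in Ioo 0 L, v₀ x * ψ x) * deriv θ 0 := by
  have hθ' : ContDiff ℝ ∞ (deriv θ) := (contDiff_infty_iff_deriv.1 hθ).2
  have hψ' : ContDiff ℝ ∞ (deriv ψ) := (contDiff_infty_iff_deriv.1 hψ).2
  have hdθ := hθ.differentiable (by simp)
  have hdψ := hψ.differentiable (by simp)
  have huψ : LocallyIntegrableOn (fun z => u z * ψ z.2) (closedStrip L) :=
    locallyIntegrableOn_mul_snd
      (hu.locallyIntegrableOn (isClosed_closedStrip L).measurableSet) hψ.continuous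
  have hf := locallyIntegrableOn_forceDensity (κ₁ := κ₁) hw hh hψ
  have hθ'' : Continuous (deriv (deriv θ)) := hθ'.continuous_deriv (by simp)
  have htest := hweak (fun z => θ z.1 * ψ z.2)
    ((hθ.comp contDiff_fst).mul (hψ.comp contDiff_snd)) (hasCompactSupport_mul_fst_snd hθc hψc)
    (by simp [partialX_mul_fst_snd hdθ hdψ, hψ0]) (by simp [partialX_mul_fst_snd hdθ hdψ, hψL])
  rw [partialT_mul_fst_snd hdθ hdψ, partialT_mul_fst_snd (hθ'.differentiable (by simp)) hdψ,
    partialX_mul_fst_snd hdθ hdψ, partialX_mul_fst_snd hdθ (hψ'.differentiable (by simp))] at htest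
  have hsplit : ∫ z in strip L, (u z * (deriv (deriv θ) z.1 * ψ z.2)
      + κ₁ ^ 2 * weakDxx L u z * (θ z.1 * deriv (deriv ψ) z.2) + h z * (θ z.1 * ψ z.2)) =
      (∫ z in strip L, u z * ψ z.2 * deriv (deriv θ) z.1) +
        ∫ z in strip L, forceDensity κ₁ L u h ψ z * θ z.1 := by
    rw [← integral_add (integrableOn_strip_mul huψ hθ'' hθc.deriv.deriv)
      (integrableOn_strip_mul hf hθ.continuous hθc)]
    congr with z
    rw [forceDensity]
    ring
  rw [← setIntegral_strip_mul huψ hθ'' hθc.deriv.deriv,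
    ← setIntegral_strip_mul hf hθ.continuous hθc, ← hsplit]
  simp only [mul_left_comm _ (θ 0), mul_left_comm _ (deriv θ 0), integral_const_mul] at htest
  linarith

theorem IsWeakSolution.integral_mul_eq (hweak : IsWeakSolution κ₁ L v₀ v₁ u h) (hL : 0 < L)
    (hu : ContDiffOn ℝ 1 u (closedStrip L))
    (hw : LocallyIntegrableOn (weakDxx L u) (closedStrip L))
    (hh : LocallyIntegrableOn h (closedStrip L))
    (hψ : ContDiff ℝ ∞ ψ) (hψc : HasCompactSupport ψ) (hψ0 : deriv ψ 0 = 0)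
    (hψL : deriv ψ L = 0) :
    ∫ x in Ioo 0 L, u (0, x) * ψ x = ∫ x in Ioo 0 L, v₀ x * ψ x ∧
      ∀ t, 0 ≤ t → ∫ x in Ioo 0 L, timeDeriv L u (t, x) * ψ x =
        (∫ x in Ioo 0 L, v₁ x * ψ x) -
          ∫ s in (0 : ℝ)..t, ∫ x in Ioo 0 L, forceDensity κ₁ L u h ψ (s, x) := by
  have hψ₂ : ContinuousOn (fun z : ℝ × ℝ => ψ z.2) (closedStrip L) :=
    (hψ.continuous.comp continuous_snd).continuousOn
  have huψ : ContinuousOn (fun z => u z * ψ z.2) (closedStrip L) := hu.continuousOn.mul hψ₂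
  have hvψ : ContinuousOn (fun z => timeDeriv L u z * ψ z.2) (closedStrip L) :=
    (continuousOn_timeDeriv hL hu).mul hψ₂
  refine deriv_eq_of_weak_second_deriv (continuousOn_integral_section hL.le huψ)
    (continuousOn_integral_section hL.le hvψ) (fun t ht => hasDerivAt_integral_section huψ hvψ
      (fun s hs x hx => (hasDerivAt_timeDeriv hu hs (Ioo_subset_Icc_self hx)).mul_const (ψ x)) ht)
    (locallyIntegrableOn_integral_section (locallyIntegrableOn_forceDensity hw hh hψ))
    fun θ hθ hθc => hweak.apply_mul_fst_snd hu.continuousOn hw hh hψ hψc hψ0 hψL hθ hθc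

end SeparatedTest

theorem exists_contDiff_hasCompactSupport_eventuallyEq_one (L : ℝ) : ∃ ψ : ℝ → ℝ,
    ContDiff ℝ ∞ ψ ∧ HasCompactSupport ψ ∧ ∀ x ∈ Icc 0 L, ψ =ᶠ[𝓝 x] fun _ => 1 := by
  let f : ContDiffBump (0 : ℝ) := ⟨|L| + 1, |L| + 2, by positivity, by linarith⟩
  refine ⟨f, f.contDiff, f.hasCompactSupport, fun x hx => f.eventuallyEq_one_of_mem_ball ?_⟩
  rw [mem_ball_zero_iff, Real.norm_of_nonneg hx.1]
  exact (hx.2.trans (le_abs_self L)).trans_lt (lt_add_one |L|)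

section AveragedEquation

variable {κ₁ L : ℝ} {v₀ v₁ : ℝ → ℝ} {u h : ℝ × ℝ → ℝ}

theorem IsWeakSolution.spatialMean_timeDeriv_eq (hweak : IsWeakSolution κ₁ L v₀ v₁ u h)
    (hL : 0 < L) (hu : ContDiffOn ℝ 1 u (closedStrip L))
    (hw : LocallyIntegrableOn (weakDxx L u) (closedStrip L))
    (hh : LocallyIntegrableOn h (closedStrip L)) {t : ℝ} (ht : 0 ≤ t) :
    spatialMean L (timeDeriv L u) t =
      (⨍ x in Ioo 0 L, v₁ x) - ∫ s in (0 : ℝ)..t, spatialMean L h s := by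
  obtain ⟨ψ, hψ, hψc, hψ1⟩ := exists_contDiff_hasCompactSupport_eventuallyEq_one L
  have hψ' : ∀ x ∈ Icc 0 L, deriv ψ =ᶠ[𝓝 x] fun _ => 0 := fun x hx => by
    simpa using (hψ1 x hx).deriv
  have hone : ∀ x ∈ Ioo 0 L, ψ x = 1 := fun x hx => (hψ1 x (Ioo_subset_Icc_self hx)).self_of_nhds
  have htest := (hweak.integral_mul_eq hL hu hw hh hψ hψc
    (hψ' 0 ⟨le_rfl, hL.le⟩).self_of_nhds (hψ' L ⟨hL.le, le_rfl⟩).self_of_nhds).2 t ht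
  have hmul : ∀ f : ℝ → ℝ, ∫ x in Ioo 0 L, f x * ψ x = ∫ x in Ioo 0 L, f x := fun f =>
    setIntegral_congr_fun measurableSet_Ioo fun x hx => by simp only [hone x hx, mul_one]
  have hforce : ∀ s, ∫ x in Ioo 0 L, forceDensity κ₁ L u h ψ (s, x) = ∫ x in Ioo 0 L, h (s, x) :=
    fun s => setIntegral_congr_fun measurableSet_Ioo fun x hx => by
      have hψ'' : deriv (deriv ψ) x = 0 := by
        simpa using (hψ' x (Ioo_subset_Icc_self hx)).deriv_eq
      simp only [forceDensity, hone x hx, hψ'', mul_zero, zero_add, mul_one]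
  simp only [hmul, hforce] at htest
  simp only [spatialMean_eq hL.le, intervalIntegral.integral_const_mul, setAverage_eq,
    Real.volume_real_Ioo_of_le hL.le, sub_zero, smul_eq_mul, htest, mul_sub]

theorem IsWeakSolution.ae_eq_initial (hweak : IsWeakSolution κ₁ L v₀ v₁ u h)
    (hL : 0 < L) (hu : ContDiffOn ℝ 1 u (closedStrip L))
    (hw : LocallyIntegrableOn (weakDxx L u) (closedStrip L))
    (hh : LocallyIntegrableOn h (closedStrip L)) (hv₀ : LocallyIntegrableOn v₀ (Ioo 0 L)) :
    (fun x => u (0, x)) =ᵐ[volume.restrict (Ioo 0 L)] v₀ := by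
  refine ae_eq_of_forall_integral_mul_eq isOpen_Ioo
    (integrableOn_section hu.continuousOn le_rfl).locallyIntegrableOn hv₀ fun ψ hψ hψc hs => ?_
  have hderiv : ∀ x ∉ Ioo 0 L, deriv ψ x = 0 := fun x hx =>
    image_eq_zero_of_notMem_tsupport fun h => hx (hs (tsupport_deriv_subset h))
  exact (hweak.integral_mul_eq hL hu hw hh hψ hψc (hderiv 0 (by simp)) (hderiv L (by simp))).1

end AveragedEquation

section Energy

variable {κ₁ κ₂ L c₀ c₁ : ℝ} {v₀ v₁ : ℝ → ℝ} {u : ℝ × ℝ → ℝ}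

theorem weakDeriv_ae_eq_zero_of_ae_const {v : ℝ → ℝ} {c : ℝ}
    (hd : WeaklyDifferentiableAlong (Ioo 0 L) 1 v)
    (hv : ∀ᵐ x ∂(volume.restrict (Ioo 0 L)), v x = c) :
    weakDeriv L v =ᵐ[volume.restrict (Ioo 0 L)] fun _ => 0 := by
  simpa [weakDeriv] using weakDerivAlong_ae_eq_fderiv isOpen_Ioo hd contDiffOn_const hv

theorem initialEnergy_of_ae_const (hL : 0 ≤ L) (hH : MemH2 L v₀)
    (hv₀ : ∀ᵐ x ∂(volume.restrict (Ioo 0 L)), v₀ x = c₀)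
    (hv₁ : ∀ᵐ x ∂(volume.restrict (Ioo 0 L)), v₁ x = c₁) :
    initialEnergy κ₁ κ₂ L v₀ v₁ = L * (c₁ ^ 2 / 2 + potential κ₂ c₀) := by
  obtain ⟨-, hd, -, hd2, -⟩ := hH
  have hconst : ∀ᵐ x ∂(volume.restrict (Ioo 0 L)), ((v₁ x) ^ 2
      + κ₁ ^ 2 * (weakDeriv L (weakDeriv L v₀) x) ^ 2) / 2 + potential κ₂ (v₀ x)
      = c₁ ^ 2 / 2 + potential κ₂ c₀ := by
    filter_upwards [hv₀, hv₁, weakDeriv_ae_eq_zero_of_ae_const hd2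
      (weakDeriv_ae_eq_zero_of_ae_const hd hv₀)] with x h₀ h₁ h₂
    rw [h₀, h₁, h₂]
    ring
  rw [initialEnergy, stateEnergy, integral_congr_ae hconst]
  simp [hL]

theorem integral_sq_add_potential_le_stateEnergy {w p q : ℝ → ℝ}
    (hwp : IntegrableOn (fun x => p x ^ 2 / 2 + potential κ₂ (w x)) (Ioo 0 L)) (hq : MemL2 L q) :
    ∫ x in Ioo 0 L, (p x ^ 2 / 2 + potential κ₂ (w x)) ≤ stateEnergy κ₁ κ₂ L w p q := by
  have hsplit : stateEnergy κ₁ κ₂ L w p q = (∫ x in Ioo 0 L, (p x ^ 2 / 2 + potential κ₂ (w x))) +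
      ∫ x in Ioo 0 L, κ₁ ^ 2 / 2 * q x ^ 2 := by
    rw [stateEnergy, ← integral_add hwp (hq.integrable_sq.const_mul _)]
    congr with x
    ring
  rw [hsplit]
  exact le_add_of_nonneg_right (integral_nonneg fun x => by positivity)

namespace IsDissipativeSolution

theorem integral_timeDeriv_sq_add_potential_le (hL : 0 < L)
    (hu : IsDissipativeSolution κ₁ κ₂ L v₀ v₁ u) (hC1 : ContDiffOn ℝ 1 u (closedStrip L))
    {t : ℝ} (ht : 0 ≤ t) :
    ∫ x in Ioo 0 L, (timeDeriv L u (t, x) ^ 2 / 2 + potential κ₂ (u (t, x)))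
      ≤ initialEnergy κ₁ κ₂ L v₀ v₁ := by
  set e : ℝ → ℝ := fun t =>
    ∫ x in Ioo 0 L, (timeDeriv L u (t, x) ^ 2 / 2 + potential κ₂ (u (t, x)))
  set K := initialEnergy κ₁ κ₂ L v₀ v₁
  have hF : ContinuousOn (fun z => timeDeriv L u z ^ 2 / 2 + potential κ₂ (u z)) (closedStrip L) :=
    (((continuousOn_timeDeriv hL hC1).pow 2).div_const 2).add
      ((continuous_potential κ₂).comp_continuousOn hu.continuousOn)
  have hdt := weakDt_ae_eq_timeDeriv hC1 hu.exists_dt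
  obtain ⟨hm, C, hC⟩ := hu.dxx_mem
  rw [strip, volume_restrict_prod] at hdt
  rw [volume_restrict_prod] at hm
  have hae : ∀ᵐ t ∂(volume.restrict (Ioi (0 : ℝ))), e t ≤ K := by
    filter_upwards [hu.dissipation, Measure.ae_ae_of_ae_prod hdt, hm.prodMk_left, hC,
      ae_restrict_mem measurableSet_Ioi] with t hK hvel hmeas hnorm hpos
    refine le_trans ?_ hK
    have hcongr : energy κ₁ κ₂ L u t = stateEnergy κ₁ κ₂ L (fun x => u (t, x))
        (fun x => timeDeriv L u (t, x)) (fun x => weakDxx L u (t, x)) := by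
      refine integral_congr_ae ?_
      filter_upwards [hvel] with x hx
      rw [hx]
    rw [hcongr]
    exact integral_sq_add_potential_le_stateEnergy (integrableOn_section hF (le_of_lt hpos))
      ⟨hmeas, hnorm.trans_lt ENNReal.coe_lt_top⟩
  have hmax : (fun t => max (e t) K) =ᵐ[volume.restrict (Ici (0 : ℝ))] fun _ => K := by
    rw [← restrict_Ioi_eq_restrict_Ici]
    filter_upwards [hae] with t ht
    exact max_eq_right ht
  exact max_eq_right_iff.1 (Measure.eqOn_of_ae_eq hmax
    ((continuousOn_integral_section hL.le hF).sup continuousOn_const) continuousOn_const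
    (by rw [interior_Ici, closure_Ioi]) ht)

theorem spatialMean_timeDeriv_sq_add_potential_le (hL : 0 < L)
    (hu : IsDissipativeSolution κ₁ κ₂ L v₀ v₁ u) (hC1 : ContDiffOn ℝ 1 u (closedStrip L))
    {t : ℝ} (ht : 0 ≤ t) :
    spatialMean L (fun z => timeDeriv L u z ^ 2) t / 2 +
      spatialMean L (fun z => potential κ₂ (u z)) t ≤ L⁻¹ * initialEnergy κ₁ κ₂ L v₀ v₁ := by
  have hkin : IntegrableOn (fun x => timeDeriv L u (t, x) ^ 2 / 2) (Ioo 0 L) :=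
    (integrableOn_section ((continuousOn_timeDeriv hL hC1).pow 2) ht).div_const 2
  have hpot : IntegrableOn (fun x => potential κ₂ (u (t, x))) (Ioo 0 L) :=
    integrableOn_section ((continuous_potential κ₂).comp_continuousOn hC1.continuousOn) ht
  have hle := hu.integral_timeDeriv_sq_add_potential_le hL hC1 ht
  rw [integral_add hkin hpot, integral_div] at hle
  rw [spatialMean_eq hL.le, spatialMean_eq hL.le, mul_div_assoc, ← mul_add]
  exact mul_le_mul_of_nonneg_left hle (inv_nonneg.2 hL.le)

theorem exists_force (hu : IsDissipativeSolution κ₁ κ₂ L v₀ v₁ u) : ∃ h : ℝ × ℝ → ℝ,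
    LocallyIntegrableOn h (closedStrip L) ∧
      (∀ᵐ z ∂(volume.restrict (strip L)), h z ∈ subdifferential (potential κ₂) (u z)) ∧
      IsWeakSolution κ₁ L v₀ v₁ u h := by
  obtain ⟨h, hm, hsub, hweak⟩ := hu.weak
  refine ⟨h, locallyIntegrableOn_closedStrip_of_ae_bound
    (C := Real.toNNReal (κ₂ ^ 2)) hm ?_, hsub, hweak⟩
  filter_upwards [hsub] with z hz
  exact mem_closedBall_zero_iff.1
    (subdifferential_subset_closedBall_of_lipschitzWith (lipschitzWith_potential κ₂) _ hz)

end IsDissipativeSolution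

/-- What the weak formulation and the energy inequality say about a `C¹` dissipative solution with
constant data `c₀`, `c₁` once the bending energy is discarded: the mean velocity is driven by the
mean of the adhesive force `h`, and the kinetic plus adhesive energy per unit length does not
exceed its initial value. -/
structure IsAveragedSolution (κ₂ L c₀ c₁ : ℝ) (u h : ℝ × ℝ → ℝ) : Prop where
  contDiffOn : ContDiffOn ℝ 1 u (closedStrip L)
  eq_initial : ∀ x ∈ Icc 0 L, u (0, x) = c₀
  force_mem : ∀ᵐ z ∂(volume.restrict (strip L)), h z ∈ subdifferential (potential κ₂) (u z)
  meanVelocity_zero : spatialMean L (timeDeriv L u) 0 = c₁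
  meanVelocity_sub : ∀ a b, 0 ≤ a → a ≤ b →
    spatialMean L (timeDeriv L u) b - spatialMean L (timeDeriv L u) a =
      -∫ s in a..b, spatialMean L h s
  energy_le : ∀ t, 0 ≤ t → spatialMean L (fun z => timeDeriv L u z ^ 2) t / 2 +
    spatialMean L (fun z => potential κ₂ (u z)) t ≤ c₁ ^ 2 / 2 + potential κ₂ c₀

theorem IsDissipativeSolution.exists_isAveragedSolution (hL : 0 < L)
    (hu : IsDissipativeSolution κ₁ κ₂ L v₀ v₁ u) (hC1 : ContDiffOn ℝ 1 u (closedStrip L))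
    (hv₀ : ∀ᵐ x ∂(volume.restrict (Ioo 0 L)), v₀ x = c₀)
    (hv₁ : ∀ᵐ x ∂(volume.restrict (Ioo 0 L)), v₁ x = c₁) :
    ∃ h, IsAveragedSolution κ₂ L c₀ c₁ u h := by
  obtain ⟨h, hh, hsub, hweak⟩ := hu.exists_force
  have hw := hu.dxx_mem.locallyIntegrableOn
  have hmean : ⨍ x in Ioo 0 L, v₁ x = c₁ := by
    rw [average_congr hv₁, setAverage_const (by simpa using hL) (by simp)]
  have hvel {t : ℝ} (ht : 0 ≤ t) := hweak.spatialMean_timeDeriv_eq hL hC1 hw hh ht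
  have hint {t : ℝ} (ht : 0 ≤ t) : IntervalIntegrable (spatialMean L h) volume 0 t := by
    simp only [funext (spatialMean_eq hL.le h)]
    exact (intervalIntegrable_of_locallyIntegrableOn_Ici
      (locallyIntegrableOn_integral_section hh) le_rfl ht).const_mul _
  refine ⟨h, hC1, ?_, hsub, ?_, fun a b ha hab => ?_, fun t ht => ?_⟩
  · refine Measure.eqOn_Icc_of_ae_eq volume hL.ne ?_ (continuousOn_section hC1.continuousOn le_rfl)
      continuousOn_const
    rw [← restrict_Ioo_eq_restrict_Icc]
    exact (hweak.ae_eq_initial hL hC1 hw hh hu.memH2_data.2.1.hasWeakDerivAlong.1).trans hv₀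
  · rw [hvel le_rfl, hmean, intervalIntegral.integral_same, sub_zero]
  · rw [hvel ha, hvel (ha.trans hab), sub_sub_sub_cancel_left, ← neg_sub,
      intervalIntegral.integral_interval_sub_left (hint (ha.trans hab)) (hint ha)]
  · rw [← inv_mul_cancel_left₀ hL.ne' (c₁ ^ 2 / 2 + potential κ₂ c₀),
      ← initialEnergy_of_ae_const hL.le hu.memH2_data hv₀ hv₁]
    exact hu.spatialMean_timeDeriv_sq_add_potential_le hL hC1 ht

end Energy

/-- The times at which the beam is straight, i.e. its displacement does not depend on `x`, and its
mean velocity and displacement account for the whole energy `E` per unit length. -/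
def homogeneousTimes (κ₂ L E : ℝ) (u : ℝ × ℝ → ℝ) : Set ℝ :=
  {t | 0 ≤ t ∧ (∀ x ∈ Icc 0 L, u (t, x) = u (t, 0)) ∧
    spatialMean L (timeDeriv L u) t ^ 2 / 2 + potential κ₂ (u (t, 0)) = E}

theorem spatialMean_of_mem_homogeneousTimes {κ₂ L E t : ℝ} {u : ℝ × ℝ → ℝ} (hL : 0 < L)
    (ht : t ∈ homogeneousTimes κ₂ L E u) (f : ℝ → ℝ) :
    spatialMean L (fun z => f (u z)) t = f (u (t, 0)) :=
  spatialMean_eq_of_forall hL fun x hx => congr_arg f (ht.2.1 x hx)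

theorem isClosed_homogeneousTimes {κ₂ L : ℝ} {u : ℝ × ℝ → ℝ} (hL : 0 < L)
    (hu : ContDiffOn ℝ 1 u (closedStrip L)) (E : ℝ) :
    IsClosed (homogeneousTimes κ₂ L E u) := by
  have hsec {x : ℝ} (hx : x ∈ Icc 0 L) : ContinuousOn (fun t => u (t, x)) (Ici 0) :=
    continuousOn_time_section hu.continuousOn hx
  have h0 : (0 : ℝ) ∈ Icc 0 L := ⟨le_rfl, hL.le⟩
  have hstraight (x : Icc 0 L) :
      IsClosed (Ici 0 ∩ (fun t => u (t, x) - u (t, 0)) ⁻¹' {0}) :=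
    ((hsec x.2).sub (hsec h0)).preimage_isClosed_of_isClosed isClosed_Ici isClosed_singleton
  have henergy : IsClosed (Ici 0 ∩ (fun t => spatialMean L (timeDeriv L u) t ^ 2 / 2 +
      potential κ₂ (u (t, 0))) ⁻¹' {E}) :=
    ((((continuousOn_spatialMean hL.le (continuousOn_timeDeriv hL hu)).pow 2).div_const 2).add
      ((continuous_potential κ₂).comp_continuousOn
        (hsec h0))).preimage_isClosed_of_isClosed isClosed_Ici isClosed_singleton
  convert (isClosed_iInter hstraight).inter henergy using 1
  ext t
  simp only [homogeneousTimes, mem_ofPred_eq, mem_inter_iff, mem_iInter, mem_Ici, mem_preimage,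
    mem_singleton_iff, sub_eq_zero, Subtype.forall]
  exact ⟨fun ⟨hpos, hs, hE⟩ => ⟨fun x hx => ⟨hpos, hs x hx⟩, hpos, hE⟩,
    fun ⟨hs, hpos, hE⟩ => ⟨hpos, fun x hx => (hs x hx).2, hE⟩⟩

namespace IsAveragedSolution

variable {κ₂ L c₀ c₁ t : ℝ} {u h : ℝ × ℝ → ℝ}

theorem continuousOn_meanVelocity (hw : IsAveragedSolution κ₂ L c₀ c₁ u h) (hL : 0 < L) :
    ContinuousOn (spatialMean L (timeDeriv L u)) (Ici 0) :=
  continuousOn_spatialMean hL.le (continuousOn_timeDeriv hL hw.contDiffOn)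

theorem continuousOn_spatialMean (hw : IsAveragedSolution κ₂ L c₀ c₁ u h) (hL : 0 < L) :
    ContinuousOn (spatialMean L u) (Ici 0) :=
  Beam.continuousOn_spatialMean hL.le hw.contDiffOn.continuousOn

theorem timeDeriv_eq_meanVelocity (hw : IsAveragedSolution κ₂ L c₀ c₁ u h) (hL : 0 < L)
    (ht : 0 ≤ t) (hE : c₁ ^ 2 / 2 + potential κ₂ c₀ ≤ spatialMean L (timeDeriv L u) t ^ 2 / 2 +
      spatialMean L (fun z => potential κ₂ (u z)) t) :
    ∀ x ∈ Icc 0 L, timeDeriv L u (t, x) = spatialMean L (timeDeriv L u) t :=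
  eq_spatialMean_of_spatialMean_sq_le hL (continuousOn_timeDeriv hL hw.contDiffOn) ht
    (by linarith [hw.energy_le t ht])

theorem timeDeriv_eq_meanVelocity_of_mem_homogeneousTimes
    (hw : IsAveragedSolution κ₂ L c₀ c₁ u h) (hL : 0 < L)
    (ht : t ∈ homogeneousTimes κ₂ L (c₁ ^ 2 / 2 + potential κ₂ c₀) u) :
    ∀ x ∈ Icc 0 L, timeDeriv L u (t, x) = spatialMean L (timeDeriv L u) t :=
  hw.timeDeriv_eq_meanVelocity hL ht.1
    (by rw [spatialMean_of_mem_homogeneousTimes hL ht, ht.2.2])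

theorem zero_mem_homogeneousTimes (hw : IsAveragedSolution κ₂ L c₀ c₁ u h) (hL : 0 < L) :
    0 ∈ homogeneousTimes κ₂ L (c₁ ^ 2 / 2 + potential κ₂ c₀) u := by
  have h0 : u (0, 0) = c₀ := hw.eq_initial 0 ⟨le_rfl, hL.le⟩
  exact ⟨le_rfl, fun x hx => (hw.eq_initial x hx).trans h0.symm, by
    rw [hw.meanVelocity_zero, h0]⟩

section QuadraticPhase

variable {k d a b : ℝ}

theorem spatialMean_force_ae_eq (hw : IsAveragedSolution κ₂ L c₀ c₁ u h) (hL : 0 < L)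
    (ha : 0 ≤ a) (hΦ : ∀ t ∈ Ioo a b, ∀ x ∈ Icc 0 L,
      potential κ₂ =ᶠ[𝓝 (u (t, x))] fun r => k * r ^ 2 / 2 + d) :
    ∀ᵐ t ∂(volume.restrict (Ioo a b)), spatialMean L h t = k * spatialMean L u t := by
  have hforce := hw.force_mem
  rw [strip, volume_restrict_prod] at hforce
  have hsub : Ioo a b ⊆ Ioi 0 := fun t ht => ha.trans_lt ht.1
  filter_upwards [ae_restrict_of_ae_restrict_of_subset hsub (Measure.ae_ae_of_ae_prod hforce),
    ae_restrict_mem measurableSet_Ioo] with t hforce_t ht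
  have hlin : ∀ᵐ x ∂(volume.restrict (Ioo 0 L)), h (t, x) = k * u (t, x) := by
    filter_upwards [hforce_t, ae_restrict_mem measurableSet_Ioo] with x hx hxL
    exact eq_mul_of_mem_subdifferential (hΦ t ht x (Ioo_subset_Icc_self hxL)) hx
  rw [spatialMean_eq hL.le, spatialMean_eq hL.le, integral_congr_ae hlin, integral_const_mul]
  ring

theorem hasDerivAt_meanVelocity (hw : IsAveragedSolution κ₂ L c₀ c₁ u h) (hL : 0 < L)
    (ha : 0 ≤ a) (hΦ : ∀ t ∈ Ioo a b, ∀ x ∈ Icc 0 L,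
      potential κ₂ =ᶠ[𝓝 (u (t, x))] fun r => k * r ^ 2 / 2 + d) (ht : t ∈ Ioo a b) :
    HasDerivAt (spatialMean L (timeDeriv L u)) (-(k * spatialMean L u t)) t := by
  have hcont : ContinuousOn (fun s => k * spatialMean L u s) (Ici 0) :=
    continuousOn_const.mul (hw.continuousOn_spatialMean hL)
  have hformula : ∀ s ∈ Ioo a b, spatialMean L (timeDeriv L u) s =
      spatialMean L (timeDeriv L u) a - ∫ r in a..s, k * spatialMean L u r := by
    intro s hs
    have hforce : ∫ r in a..s, spatialMean L h r = ∫ r in a..s, k * spatialMean L u r := by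
      rw [intervalIntegral.integral_of_le hs.1.le, intervalIntegral.integral_of_le hs.1.le]
      exact integral_congr_ae (ae_restrict_of_ae_restrict_of_subset
        (Ioc_subset_Ioo_right hs.2) (hw.spatialMean_force_ae_eq hL ha hΦ))
    linarith [hw.meanVelocity_sub a s ha hs.1.le]
  have hnhds : Ici 0 ∈ 𝓝 t := Ici_mem_nhds (ha.trans_lt ht.1)
  have hprim : HasDerivAt (fun s => ∫ r in a..s, k * spatialMean L u r)
      (k * spatialMean L u t) t :=
    intervalIntegral.integral_hasDerivAt_right
      ((hcont.mono (Icc_subset_Ici_self.trans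
        (Ici_subset_Ici.2 ha))).intervalIntegrable_of_Icc ht.1.le)
      ((hcont.mono Ioi_subset_Ici_self).stronglyMeasurableAtFilter isOpen_Ioi t
        (ha.trans_lt ht.1))
      (hcont.continuousAt hnhds)
  exact (hprim.const_sub _).congr_of_eventuallyEq
    (mem_of_superset (isOpen_Ioo.mem_nhds ht) hformula)

theorem meanEnergy_eq (hw : IsAveragedSolution κ₂ L c₀ c₁ u h) (hL : 0 < L)
    (ha : 0 ≤ a) (hΦ : ∀ t ∈ Ioo a b, ∀ x ∈ Icc 0 L,
      potential κ₂ =ᶠ[𝓝 (u (t, x))] fun r => k * r ^ 2 / 2 + d) (ht : t ∈ Ioo a b) :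
    spatialMean L (timeDeriv L u) t ^ 2 / 2 + k * spatialMean L u t ^ 2 / 2 =
      spatialMean L (timeDeriv L u) a ^ 2 / 2 + k * spatialMean L u a ^ 2 / 2 := by
  have hsub : Icc a t ⊆ Ici 0 := fun s hs => ha.trans hs.1
  have hcont : ContinuousOn (fun s => spatialMean L (timeDeriv L u) s ^ 2 / 2 +
      k * spatialMean L u s ^ 2 / 2) (Icc a t) :=
    ((((hw.continuousOn_meanVelocity hL).pow 2).div_const 2).add
      ((continuousOn_const.mul ((hw.continuousOn_spatialMean hL).pow 2)).div_const 2)).mono hsub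
  obtain ⟨s, -, hs⟩ := exists_hasDerivAt_eq_slope _ (fun _ => 0) ht.1 hcont fun s hs => by
    have hp := hw.hasDerivAt_meanVelocity hL ha hΦ ⟨hs.1, hs.2.trans ht.2⟩
    have hy := hasDerivAt_spatialMean hL hw.contDiffOn (ha.trans_lt hs.1)
    exact (((hp.pow 2).div_const 2).add (((hy.pow 2).const_mul k).div_const 2)).congr_deriv
      (by norm_num; ring)
  have := (div_eq_zero_iff.1 hs.symm).resolve_right (sub_pos.2 ht.1).ne'
  linarith

theorem potential_eq_of_quadratic (hw : IsAveragedSolution κ₂ L c₀ c₁ u h) (hL : 0 < L)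
    (ha : 0 ≤ a) (hab : a < b) (hΦ : ∀ t ∈ Ioo a b, ∀ x ∈ Icc 0 L,
      potential κ₂ =ᶠ[𝓝 (u (t, x))] fun r => k * r ^ 2 / 2 + d) :
    potential κ₂ (u (a, 0)) = k * u (a, 0) ^ 2 / 2 + d := by
  have h0 : (0 : ℝ) ∈ Icc 0 L := ⟨le_rfl, hL.le⟩
  have hsec : Tendsto (fun t => u (t, 0)) (𝓝[>] a) (𝓝 (u (a, 0))) :=
    (continuousOn_time_section hw.contDiffOn.continuousOn h0 a ha).mono_left
      (nhdsWithin_mono a fun _ hs => ha.trans (le_of_lt hs))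
  have hquad : Continuous fun r : ℝ => k * r ^ 2 / 2 + d := by fun_prop
  refine tendsto_nhds_unique (((continuous_potential κ₂).tendsto _).comp hsec)
    (((hquad.tendsto _).comp hsec).congr' ?_)
  filter_upwards [Ioo_mem_nhdsGT hab] with t ht
  exact (hΦ t ht 0 h0).self_of_nhds.symm

theorem timeDeriv_eq_meanVelocity_of_quadratic (hw : IsAveragedSolution κ₂ L c₀ c₁ u h)
    (hL : 0 < L) (hk : 0 ≤ k) (ha : a ∈ homogeneousTimes κ₂ L (c₁ ^ 2 / 2 + potential κ₂ c₀) u)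
    (hΦ : ∀ t ∈ Ioo a b, ∀ x ∈ Icc 0 L,
      potential κ₂ =ᶠ[𝓝 (u (t, x))] fun r => k * r ^ 2 / 2 + d) (ht : t ∈ Ioo a b) :
    ∀ x ∈ Icc 0 L, timeDeriv L u (t, x) = spatialMean L (timeDeriv L u) t := by
  have ht₀ : 0 ≤ t := ha.1.trans ht.1.le
  refine hw.timeDeriv_eq_meanVelocity hL ht₀ ?_
  have hpot : spatialMean L (fun z => potential κ₂ (u z)) t =
      k / 2 * spatialMean L (fun z => u z ^ 2) t + d :=
    spatialMean_eq_const_mul_add hL (hw.contDiffOn.continuousOn.pow 2) ht₀ fun x hx =>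
      (hΦ t ht x hx).self_of_nhds.trans (by ring)
  have hjensen := mul_le_mul_of_nonneg_left (sq_spatialMean_le hL hw.contDiffOn.continuousOn ht₀) hk
  have hcons := hw.meanEnergy_eq hL ha.1 hΦ ht
  have hmean_a : spatialMean L u a = u (a, 0) := spatialMean_of_mem_homogeneousTimes hL ha id
  have hE := ha.2.2
  rw [hw.potential_eq_of_quadratic hL ha.1 (ht.1.trans ht.2) hΦ] at hE
  rw [hpot]
  rw [hmean_a] at hcons
  linarith

theorem Ioo_subset_homogeneousTimes (hw : IsAveragedSolution κ₂ L c₀ c₁ u h)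
    (hL : 0 < L) (hk : 0 ≤ k) (ha : a ∈ homogeneousTimes κ₂ L (c₁ ^ 2 / 2 + potential κ₂ c₀) u)
    (hΦ : ∀ t ∈ Ioo a b, ∀ x ∈ Icc 0 L,
      potential κ₂ =ᶠ[𝓝 (u (t, x))] fun r => k * r ^ 2 / 2 + d) :
    Ioo a b ⊆ homogeneousTimes κ₂ L (c₁ ^ 2 / 2 + potential κ₂ c₀) u := by
  intro t ht
  have h0 : (0 : ℝ) ∈ Icc 0 L := ⟨le_rfl, hL.le⟩
  have hvel (s : ℝ) (hs : s ∈ Ioo a b) :=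
    hw.timeDeriv_eq_meanVelocity_of_quadratic hL hk ha hΦ hs
  have hstraight : ∀ x ∈ Icc 0 L, u (t, x) = u (t, 0) := by
    intro x hx
    have hdisp := sub_eq_sub_of_timeDeriv_eq hL hw.contDiffOn ha.1 ht.1.le hx h0 fun s hs =>
      (hvel s ⟨hs.1, hs.2.trans ht.2⟩ x hx).trans (hvel s ⟨hs.1, hs.2.trans ht.2⟩ 0 h0).symm
    linarith [ha.2.1 x hx]
  have hcons := hw.meanEnergy_eq hL ha.1 hΦ ht
  rw [spatialMean_eq_of_forall hL hstraight, spatialMean_eq_of_forall hL ha.2.1] at hcons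
  refine ⟨ha.1.trans ht.1.le, hstraight, ?_⟩
  rw [(hΦ t ht 0 h0).self_of_nhds]
  have hE := ha.2.2
  rw [hw.potential_eq_of_quadratic hL ha.1 (ht.1.trans ht.2) hΦ] at hE
  linarith

end QuadraticPhase

variable {t₀ T : ℝ}

theorem eventually_attached_or_detached_of_abs_eq_one (hw : IsAveragedSolution κ₂ L c₀ c₁ u h)
    (hL : 0 < L) (hE : c₁ ^ 2 / 2 + potential κ₂ c₀ ≠ κ₂ ^ 2 / 2)
    (ht₀ : t₀ ∈ homogeneousTimes κ₂ L (c₁ ^ 2 / 2 + potential κ₂ c₀) u)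
    (habs : |u (t₀, 0)| = 1) :
    (∀ᶠ t in 𝓝[>] t₀, ∀ x ∈ Icc 0 L, |u (t, x)| < 1) ∨
      ∀ᶠ t in 𝓝[>] t₀, ∀ x ∈ Icc 0 L, 1 < |u (t, x)| := by
  have hvel := hw.timeDeriv_eq_meanVelocity_of_mem_homogeneousTimes hL ht₀
  set p := spatialMean L (timeDeriv L u) t₀
  set c := u (t₀, 0)
  have hcc : c * c = 1 := by rw [← abs_mul_abs_self, habs, mul_one]
  have hc_mul (s : ℝ) : |c * s| = |s| := by rw [abs_mul, habs, one_mul]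
  have hp : p ≠ 0 := by
    intro hp
    have := ht₀.2.2
    rw [potential_of_one_le_abs habs.ge, show spatialMean L (timeDeriv L u) t₀ = 0 from hp] at this
    exact hE (by linarith)
  have hcp : c * p ≠ 0 := mul_ne_zero (left_ne_zero_of_mul_eq_one hcc) hp
  rcases hcp.lt_or_gt with hneg | hpos
  · left
    have hdecr := eventually_nhdsGT_forall_mul_lt (c := -c) hL hw.contDiffOn ht₀.1
      fun x hx => by rw [hvel x hx]; linarith
    have hlower : ∀ᶠ t in 𝓝[>] t₀, ∀ x ∈ Icc 0 L, c * u (t, x) ∈ Ioi (-1) :=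
      nhdsWithin_mono t₀ Ioi_subset_Ici_self <| eventually_nhdsGE_forall_section
        (continuousOn_const.mul hw.contDiffOn.continuousOn) isOpen_Ioi ht₀.1
        fun x hx => show -1 < c * u (t₀, x) by rw [ht₀.2.1 x hx, hcc]; norm_num
    filter_upwards [hdecr, hlower] with t hlt hgt x hx
    have := hlt x hx
    rw [ht₀.2.1 x hx] at this
    rw [← hc_mul, abs_lt]
    exact ⟨hgt x hx, by linarith⟩
  · right
    filter_upwards [eventually_nhdsGT_forall_mul_lt (c := c) hL hw.contDiffOn ht₀.1
      fun x hx => by rwa [hvel x hx]] with t hlt x hx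
    have := hlt x hx
    rw [ht₀.2.1 x hx, hcc] at this
    rw [← hc_mul]
    exact this.trans_le (le_abs_self _)

theorem eventually_attached_or_detached (hw : IsAveragedSolution κ₂ L c₀ c₁ u h)
    (hL : 0 < L) (hE : c₁ ^ 2 / 2 + potential κ₂ c₀ ≠ κ₂ ^ 2 / 2)
    (ht₀ : t₀ ∈ homogeneousTimes κ₂ L (c₁ ^ 2 / 2 + potential κ₂ c₀) u) :
    (∀ᶠ t in 𝓝[>] t₀, ∀ x ∈ Icc 0 L, |u (t, x)| < 1) ∨
      ∀ᶠ t in 𝓝[>] t₀, ∀ x ∈ Icc 0 L, 1 < |u (t, x)| := by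
  have hmono : 𝓝[>] t₀ ≤ 𝓝[≥] t₀ := nhdsWithin_mono t₀ Ioi_subset_Ici_self
  have hcont : ContinuousOn (fun z => |u z|) (closedStrip L) := hw.contDiffOn.continuousOn.abs
  rcases lt_trichotomy |u (t₀, 0)| 1 with hlt | heq | hgt
  · exact .inl (hmono (eventually_nhdsGE_forall_section hcont isOpen_Iio ht₀.1
      fun x hx => by rwa [ht₀.2.1 x hx]))
  · exact hw.eventually_attached_or_detached_of_abs_eq_one hL hE ht₀ heq
  · exact .inr (hmono (eventually_nhdsGE_forall_section hcont isOpen_Ioi ht₀.1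
      fun x hx => by rwa [ht₀.2.1 x hx]))

theorem homogeneousTimes_mem_nhdsGT (hw : IsAveragedSolution κ₂ L c₀ c₁ u h)
    (hL : 0 < L) (hE : c₁ ^ 2 / 2 + potential κ₂ c₀ ≠ κ₂ ^ 2 / 2)
    (ht₀ : t₀ ∈ homogeneousTimes κ₂ L (c₁ ^ 2 / 2 + potential κ₂ c₀) u) :
    homogeneousTimes κ₂ L (c₁ ^ 2 / 2 + potential κ₂ c₀) u ∈ 𝓝[>] t₀ := by
  rcases hw.eventually_attached_or_detached hL hE ht₀ with hattached | hdetached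
  · obtain ⟨b, hb, hattached⟩ := mem_nhdsGT_iff_exists_Ioo_subset.1 hattached
    refine mem_nhdsGT_iff_exists_Ioo_subset.2 ⟨b, hb, hw.Ioo_subset_homogeneousTimes hL
      (sq_nonneg κ₂) ht₀ (d := 0) fun t ht x hx => ?_⟩
    simpa using potential_eventuallyEq_of_abs_lt_one (hattached ht x hx)
  · obtain ⟨b, hb, hdetached⟩ := mem_nhdsGT_iff_exists_Ioo_subset.1 hdetached
    refine mem_nhdsGT_iff_exists_Ioo_subset.2 ⟨b, hb, hw.Ioo_subset_homogeneousTimes hL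
      le_rfl ht₀ (d := κ₂ ^ 2 / 2) fun t ht x hx => ?_⟩
    simpa using potential_eventuallyEq_of_one_lt_abs (hdetached ht x hx)

theorem mem_homogeneousTimes (hw : IsAveragedSolution κ₂ L c₀ c₁ u h) (hL : 0 < L)
    (hE : c₁ ^ 2 / 2 + potential κ₂ c₀ ≠ κ₂ ^ 2 / 2) (ht : 0 ≤ t) :
    t ∈ homogeneousTimes κ₂ L (c₁ ^ 2 / 2 + potential κ₂ c₀) u :=
  ((isClosed_homogeneousTimes hL hw.contDiffOn _).inter
    isClosed_Icc).Icc_subset_of_forall_mem_nhdsWithin (hw.zero_mem_homogeneousTimes hL)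
    (fun _ hs => hw.homogeneousTimes_mem_nhdsGT hL hE hs.1) ⟨ht, le_rfl⟩

theorem timeDeriv_eq_zero_of_detached (hw : IsAveragedSolution κ₂ L c₀ c₁ u h) (hL : 0 < L)
    (hE : c₁ ^ 2 / 2 + potential κ₂ c₀ = κ₂ ^ 2 / 2) (ht : 0 ≤ t)
    (hdetached : ∀ x ∈ Icc 0 L, 1 ≤ |u (t, x)|) :
    ∀ x ∈ Icc 0 L, timeDeriv L u (t, x) = 0 := by
  have hpot : spatialMean L (fun z => potential κ₂ (u z)) t = κ₂ ^ 2 / 2 :=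
    spatialMean_eq_of_forall hL fun x hx => potential_of_one_le_abs (hdetached x hx)
  have hjensen := sq_spatialMean_le hL (continuousOn_timeDeriv hL hw.contDiffOn) ht
  have henergy := hw.energy_le t ht
  have hzero : spatialMean L (timeDeriv L u) t = 0 :=
    pow_eq_zero_iff two_ne_zero |>.1 (le_antisymm (by linarith) (sq_nonneg _))
  intro x hx
  rw [hw.timeDeriv_eq_meanVelocity hL ht (by rw [hpot, hE, hzero]; simp) x hx, hzero]

theorem energy_ne_of_detached (hw : IsAveragedSolution κ₂ L c₀ c₁ u h) (hL : 0 < L)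
    (hc₀ : |c₀| ≤ 1) (hT : 0 ≤ T) (hdetached : ∀ x ∈ Icc 0 L, 1 < |u (T, x)|) :
    c₁ ^ 2 / 2 + potential κ₂ c₀ ≠ κ₂ ^ 2 / 2 := by
  intro hE
  have hcont : ContinuousOn (fun z => |u z|) (closedStrip L) := hw.contDiffOn.continuousOn.abs
  have h0 : (0 : ℝ) ∈ Icc 0 L := ⟨le_rfl, hL.le⟩
  obtain ⟨τ, ⟨⟨hτ₀, hτT⟩, x, hx, hτx⟩, hmax⟩ :=
    (isCompact_setOf_exists_section_mem hcont (isClosed_Iic (a := 1)) le_rfl T).exists_isGreatest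
      ⟨0, ⟨le_rfl, hT⟩, 0, h0, by rw [hw.eq_initial 0 h0]; exact hc₀⟩
  have hrest : ∀ s ∈ Ioo τ T, timeDeriv L u (s, x) = 0 := by
    intro s hs
    refine hw.timeDeriv_eq_zero_of_detached hL hE (hτ₀.trans hs.1.le) (fun y hy => ?_) x hx
    by_contra! hlt
    exact hs.1.not_ge (hmax ⟨⟨hτ₀.trans hs.1.le, hs.2.le⟩, y, hy, hlt.le⟩)
  have hconst : u (T, x) - u (τ, x) = 0 := by
    rw [← integral_timeDeriv_eq_sub hL hw.contDiffOn hτ₀ hτT hx,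
      intervalIntegral.integral_congr_Ioo_of_le hτT hrest, intervalIntegral.integral_zero]
  have hlt := hdetached x hx
  rw [sub_eq_zero.1 hconst] at hlt
  exact hlt.not_ge hτx

end IsAveragedSolution

end Beam

theorem mainTheorem1_general (κ₁ κ₂ L : ℝ) (hL : 0 < L)
    (v₀ v₁ : ℝ → ℝ) (u : ℝ × ℝ → ℝ)
    (hu : Beam.IsDissipativeSolution κ₁ κ₂ L v₀ v₁ u)
    (c₀ c₁ : ℝ)
    (hv₀ : ∀ᵐ x ∂(volume.restrict (Ioo 0 L)), v₀ x = c₀)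
    (hv₁ : ∀ᵐ x ∂(volume.restrict (Ioo 0 L)), v₁ x = c₁)
    (hC1 : ContDiffOn ℝ 1 u (Beam.closedStrip L))
    (hE : c₁ ^ 2 / 2 + Beam.potential κ₂ c₀ ≠ κ₂ ^ 2 / 2) :
    ∀ t, 0 ≤ t → ∃ c : ℝ, ∀ x ∈ Icc 0 L, u (t, x) = c := by
  obtain ⟨h, hw⟩ := hu.exists_isAveragedSolution hL hC1 hv₀ hv₁
  exact fun t ht => ⟨u (t, 0), (hw.mem_homogeneousTimes hL hE ht).2.1⟩

theorem mainTheorem1 (κ₁ κ₂ L : ℝ) (hκ₁ : 0 < κ₁) (hL : 0 < L)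
    (v₀ v₁ : ℝ → ℝ) (u : ℝ × ℝ → ℝ)
    (hu : Beam.IsDissipativeSolution κ₁ κ₂ L v₀ v₁ u)
    (c₀ c₁ : ℝ) (hc₀ : |c₀| < 1)
    (hv₀ : ∀ᵐ x ∂(volume.restrict (Ioo 0 L)), v₀ x = c₀)
    (hv₁ : ∀ᵐ x ∂(volume.restrict (Ioo 0 L)), v₁ x = c₁)
    (tbar : ℝ) (htbar : 0 < tbar) (hdetached : ∀ x ∈ Icc 0 L, 1 < |u (tbar, x)|)
    (hC1 : ContDiffOn ℝ 1 u (Beam.closedStrip L))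
    (henergy : ∀ᵐ t ∂(volume.restrict (Ioi (0 : ℝ))),
      Beam.energy κ₁ κ₂ L u t = Beam.initialEnergy κ₁ κ₂ L v₀ v₁) :
    ∀ t, tbar ≤ t → ∃ c : ℝ, ∀ x ∈ Icc 0 L, u (t, x) = c := by
  obtain ⟨h, hw⟩ := hu.exists_isAveragedSolution hL hC1 hv₀ hv₁
  exact fun t ht => mainTheorem1_general κ₁ κ₂ L hL v₀ v₁ u hu c₀ c₁ hv₀ hv₁ hC1
    (hw.energy_ne_of_detached hL hc₀.le htbar.le hdetached) t (htbar.le.trans ht)
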